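/- For a vector $x$ of length $n$ with entries in a linearly ordered set let $\kappa(x)$ be the skew-symmetric $n\times n$ matrix with $\kappa_{kl}(x)=\sqrt{1/2}$, $0$ or $-\sqrt{1/2}$ according as $x_k>x_l$, $x_k=x_l$ or $x_k<x_l$, and define the Kemeny distance of two such vectors by $$\rho_\kappa(x,y)=\frac{n^2-n}{2}+\sum_{k,l=1}^{n}\kappa_{kl}(x)\,\kappa_{lk}(y).$$ Let $\mathcal M_n$ be the set of the $n^n-n$ non-constant vectors in $\{1,\dots,n\}^n$ (rankings of $n$ items with ties). For every $n\ge 2$ let $X_n,Y_n$ be independent random vectors, each uniformly distributed on $\mathcal M_n$, and let $D_n=\rho_\kappa(X_n,Y_n)$. Then: 1. for every $n\ge 2$, $E(D_n)=\frac{n^2-n}{2}$ and $\operatorname{Var}(D_n)>0$; 2. as $n\to\infty$, $\dfrac{D_n-E(D_n)}{\sqrt{\operatorname{Var}(D_n)}}\to N(0,1)$ in distribution, and likewise $\dfrac{D_n-\frac{n^2-n}{2}}{\dot\sigma_n}\to N(0,1)$ in distribution, where $\dot\sigma_n^2=\dfrac{(n-1)^2(n+4)(2n-1)}{18n}$; 3.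 the excess kurtosis $\gamma_n=\dfrac{E\big[(D_n-E(D_n))^4\big]}{\operatorname{Var}(D_n)^2}-3$ satisfies $\gamma_n<0$ and $\gamma_n<\gamma_{n+1}$ for every $n\ge2$, and $\gamma_n\to0$ as $n\to\infty$. -/

import Mathlib

open MeasureTheory ProbabilityTheory Filter Topology
open scoped Matrix

noncomputable section

/-- The score matrix `κ(x)` of a vector `x` with entries in a linear order (such as the extended
reals or the ranks `1, …, n`): `κ_{kl}(x)` is `√.5`, `0` or `-√.5` according as `x_k > x_l`,
`x_k = x_l` or `x_k < x_l`. -/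
def kemenyScore {α : Type*} [LinearOrder α] {n : ℕ} (x : Fin n → α) :
    Matrix (Fin n) (Fin n) ℝ :=
  Matrix.of fun k l => if x l < x k then √(1 / 2) else if x k < x l then -√(1 / 2) else 0

/-- The Kemeny distance
`ρ_κ(x, y) = (n² - n) / 2 + ∑_{k,l} (κ(x) ⊙ κ(y)ᵀ)_{kl}`. -/
def kemenyDist {α β : Type*} [LinearOrder α] [LinearOrder β] {n : ℕ}
    (x : Fin n → α) (y : Fin n → β) : ℝ :=
  ((n : ℝ) ^ 2 - n) / 2 + ∑ k, ∑ l, (kemenyScore x ⊙ (kemenyScore y)ᵀ) k l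

/-- The population `𝓜` of rankings with ties of `n` items: all vectors of length `n` over `n`
ordered values, except the `n` constant ones. -/
def kemenyPopulation (n : ℕ) : Set (Fin n → Fin n) :=
  {x | ∃ k l, x k ≠ x l}

/-- The normalising variance `(n - 1)² (n + 4) (2n - 1) / (18 n)` of the Kemeny distance. -/
def kemenyPopVariance (n : ℕ) : ℝ :=
  ((n : ℝ) - 1) ^ 2 * (n + 4) * (2 * n - 1) / (18 * n)

/-- The excess kurtosis of a real random variable: fourth central moment over squared variance,
minus `3`. -/
def excessKurtosis {Ω : Type*} [MeasurableSpace Ω] (Z : Ω → ℝ) (P : Measure Ω) : ℝ :=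
  centralMoment Z 4 P / variance Z P ^ 2 - 3

end

/-!
The Kemeny distance of `x` and `y` is `(n² - n) / 2` minus half of their concordance
`∑_{k ≠ l} sign (x_k - x_l) sign (y_k - y_l)`, a sum over ordered pairs of a symmetric kernel of the
`n` points `(x_k, y_k)`. A constant vector has concordance `0` with every other vector. Hence
conditioning both vectors on being non-constant only multiplies the moments about the centre by
`p⁻²`, where `p = 1 - n / n ^ n` is the fraction of non-constant vectors, and one may compute with
all of `{1, …, n} ^ n`, where the coordinates are independent.

*Moments.* Expanding the `r`-th power of the pair sum gives a sum over sequences of `r` pairs, that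
is, over multigraphs with `r` edges, and a term depends only on the isomorphism type of its graph.
Since the kernel has mean zero, graphs with an isolated edge contribute nothing, and since it is the
product of a kernel in `x` and the same kernel in `y`, the contribution of a graph is a square. Two
types of graphs give the variance and fifteen give the fourth moment.

*Kurtosis.* It follows that `γ + 3` is `p²` times a rational function of `n`. Both `p` and, from
`n = 3` on, the rational function are increasing, and they tend to `1` and `3` from below.

*Limit.* By Hájek's method, the concordance divided by `n ^ (3 / 2)` differs in mean square by
`o(1)` from a sum of independent terms of order `n ^ (-1 / 2)`, whose characteristic function
converges by a second order Taylor expansion.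
-/

noncomputable section

open scoped BigOperators

section Sampling

theorem expect_comp_injective {ι κ α : Type*} [Fintype ι] [DecidableEq ι] [Fintype κ]
    [DecidableEq κ] [Fintype α] [Nonempty α] {f : ι → κ} (hf : f.Injective) (F : (ι → α) → ℝ) :
    𝔼 x : κ → α, F (x ∘ f) = 𝔼 y : ι → α, F y := by
  classical
  let e : (κ → α) ≃ (ι → α) × ({k // k ∉ Set.range f} → α) :=
    (Equiv.piEquivPiSubtypeProd (· ∈ Set.range f) fun _ => α).trans
      ((Equiv.arrowCongr (Equiv.ofInjective f hf).symm (Equiv.refl α)).prodCongr (Equiv.refl _))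
  have he : ∀ x, (e x).1 = x ∘ f := fun x => funext fun i => by
    simp [e, Equiv.arrowCongr, Equiv.piEquivPiSubtypeProd]
  rw [Fintype.expect_equiv e _ (fun z => F z.1) fun x => by rw [he], ← Finset.univ_product_univ,
    Finset.expect_product]
  simp only [Fintype.expect_const]

theorem extend_val_apply {α : Type*} [Inhabited α] {n : ℕ} (z : Fin n → α) (i : Fin n) :
    Function.extend Fin.val z default i = z i :=
  Fin.val_injective.extend_apply z default i

variable {α β : Type*} [Fintype α] [Inhabited α] [Fintype β] [Inhabited β] {n v : ℕ}

/-- The average of `F z` over `n` independent uniform samples `z 0, …, z (n - 1)` from `α`. The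
function `F` takes an infinite sequence so that labels may be any natural numbers; the entries of
the sequence beyond the first `n` are `default`. -/
def sampleMean (n : ℕ) (F : (ℕ → α) → ℝ) : ℝ :=
  𝔼 z : Fin n → α, F (Function.extend Fin.val z default)

theorem sampleMean_zero (F : (ℕ → α) → ℝ) : sampleMean 0 F = F default := by
  have hdefault : ∀ z : Fin 0 → α, Function.extend Fin.val z default = default :=
    fun z => funext fun i => Function.extend_apply' _ _ _ fun ⟨j, _⟩ => j.elim0
  simp only [sampleMean, hdefault, Fintype.expect_const]

theorem sampleMean_succ (F : (ℕ → α) → ℝ) :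
    sampleMean (n + 1) F = sampleMean n fun z => 𝔼 a, F (Function.update z n a) := by
  have hupdate : ∀ (a : α) (z : Fin n → α),
      Function.extend Fin.val (Fin.snoc (α := fun _ => α) z a) default =
        Function.update (Function.extend Fin.val z default) n a := by
    intro a z
    funext i
    rcases lt_trichotomy i n with hi | rfl | hi
    · lift i to Fin n using hi
      rw [Function.update_of_ne i.2.ne, extend_val_apply]
      exact (extend_val_apply _ i.castSucc).trans (Fin.snoc_castSucc ..)
    · rw [Function.update_self]
      exact (extend_val_apply _ (Fin.last i)).trans (Fin.snoc_last ..)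
    · rw [Function.update_of_ne hi.ne', Function.extend_apply' _ _ _ (by rintro ⟨j, rfl⟩; omega),
        Function.extend_apply' _ _ _ (by rintro ⟨j, rfl⟩; omega)]
  rw [sampleMean, ← Fintype.expect_equiv (Fin.snocEquiv fun _ => α)
    (fun p => F (Function.update (Function.extend Fin.val p.2 default) n p.1)) _
    fun p => congrArg F (hupdate p.1 p.2).symm, ← Finset.univ_product_univ, Finset.expect_product,
    Finset.expect_comm]
  rfl

theorem sampleMean_comp {f : ℕ → ℕ} (hinj : Set.InjOn f (Set.Iio v))
    (hmaps : Set.MapsTo f (Set.Iio v) (Set.Iio n)) {F : (ℕ → α) → ℝ}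
    (hF : DependsOn F (Set.Iio v)) :
    sampleMean n (fun z => F (z ∘ f)) = sampleMean v F := by
  let g : Fin v → Fin n := fun i => ⟨f i, hmaps i.2⟩
  have hg : g.Injective := fun i j hij => Fin.ext (hinj i.2 j.2 (congrArg Fin.val hij))
  rw [sampleMean, sampleMean, ← expect_comp_injective hg]
  refine Finset.expect_congr rfl fun z _ => hF fun i hi => ?_
  obtain ⟨i, rfl⟩ : ∃ j : Fin v, j = i := ⟨⟨i, hi⟩, rfl⟩
  rw [extend_val_apply, Function.comp_apply]
  exact extend_val_apply z (g i)

theorem sampleMean_eq_of_dependsOn (hvn : v ≤ n) {F : (ℕ → α) → ℝ}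
    (hF : DependsOn F (Set.Iio v)) : sampleMean n F = sampleMean v F :=
  sampleMean_comp (f := id) (Set.injOn_id _) (Set.Iio_subset_Iio hvn) hF

theorem sampleMean_update (i : ℕ) {F : (ℕ → α) → ℝ} (hF : DependsOn F (Set.Iio n)) :
    sampleMean n (fun z => 𝔼 a, F (Function.update z i a)) = sampleMean n F := by
  let f : ℕ → ℕ := Function.update id i n
  have hf : ∀ j, f j = if j = i then n else j := fun j => Function.update_apply id i n j
  rw [← sampleMean_comp (n := n + 1) (f := f) _ _ hF, sampleMean_succ]
  · congr! 3 with z a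
    refine hF fun j hj => ?_
    have hj' : j ≠ n := (Set.mem_Iio.mp hj).ne
    by_cases hji : j = i <;> simp [hf, hji, hj']
  · intro j hj k hk hjk
    simp only [hf, Set.mem_Iio] at hj hk hjk
    split_ifs at hjk <;> omega
  · intro j hj
    simp only [hf, Set.mem_Iio] at hj ⊢
    split_ifs <;> omega

theorem sampleMean_prod (F : (ℕ → α) → ℝ) (G : (ℕ → β) → ℝ) :
    sampleMean n (fun z : ℕ → α × β => F (Prod.fst ∘ z) * G (Prod.snd ∘ z)) =
      sampleMean n F * sampleMean n G := by
  have hfst : ∀ z : Fin n → α × β, Prod.fst ∘ Function.extend Fin.val z default =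
      Function.extend Fin.val (Prod.fst ∘ z) default := fun z =>
    funext fun i => Function.apply_extend ..
  have hsnd : ∀ z : Fin n → α × β, Prod.snd ∘ Function.extend Fin.val z default =
      Function.extend Fin.val (Prod.snd ∘ z) default := fun z =>
    funext fun i => Function.apply_extend ..
  simp only [sampleMean, hfst, hsnd]
  rw [Fintype.expect_mul_expect, ← Finset.expect_product', Finset.univ_product_univ]
  exact Fintype.expect_equiv (Equiv.arrowProdEquivProdArrow ..) _ _ fun z => rfl

end Sampling

/-- A multigraph with vertices `0, …, order - 1`, given by the list of its edges. -/
@[ext]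
structure Multigraph where
  order : ℕ
  edges : List (ℕ × ℕ)

namespace Multigraph

instance : DecidableEq Multigraph := fun _ _ => decidable_of_iff' _ Multigraph.ext_iff

/-- The labels of `G` are below its order and each edge is listed with its smaller end point
first. -/
def IsWellFormed (G : Multigraph) : Prop :=
  ∀ e ∈ G.edges, e.1 < e.2 ∧ e.2 < G.order

/-- `G` becomes `H` when its vertices are permuted, up to the order and the orientation of the
edges. -/
def IsRelabelling (G H : Multigraph) : Prop :=
  G.order = H.order ∧ ∃ σ ∈ (List.range G.order).permutations',
    (G.edges.map fun e => s(σ.getD e.1 0, σ.getD e.2 0)).Perm (H.edges.map fun e => s(e.1, e.2))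

instance (G H : Multigraph) : Decidable (G.IsRelabelling H) :=
  inferInstanceAs (Decidable (_ ∧ _))

/-- Some edge of `G` has no vertex in common with the other edges. -/
def HasIsolatedEdge (G : Multigraph) : Prop :=
  ∃ e ∈ G.edges, ∀ f ∈ G.edges.erase e, f.1 ≠ e.1 ∧ f.1 ≠ e.2 ∧ f.2 ≠ e.1 ∧ f.2 ≠ e.2

instance (G : Multigraph) : Decidable G.HasIsolatedEdge :=
  inferInstanceAs (Decidable (∃ e ∈ _, _))

/-- The graphs obtained from a weighted graph by adding one edge, up to the labels of the new
vertices. The weight is multiplied by `2` if the two end points of the new edge can be told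
apart. -/
def extensions : ℕ × Multigraph → List (ℕ × Multigraph)
  | (w, ⟨v, L⟩) =>
    ((List.range v).flatMap fun l => (List.range l).map fun k => (2 * w, ⟨v, L ++ [(k, l)]⟩)) ++
      (List.range v).map (fun k => (2 * w, ⟨v + 1, L ++ [(k, v)]⟩)) ++
      [(w, ⟨v + 2, L ++ [(v, v + 1)]⟩)]

/-- Add a weighted graph to a list, merging it with the first graph that it is a relabelling of. -/
def insertType (x : ℕ × Multigraph) : List (ℕ × Multigraph) → List (ℕ × Multigraph)
  | [] => [x]
  | y :: l => if x.2.IsRelabelling y.2 then (x.1 + y.1, y.2) :: l else y :: insertType x l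

/-- Merge the weighted graphs of a list that are relabellings of each other. -/
def mergeTypes (l : List (ℕ × Multigraph)) : List (ℕ × Multigraph) :=
  l.foldr insertType []

/-- The relabelling types of multigraphs with `r` edges, each weighted by the number of ways of
building it edge by edge. -/
def types : ℕ → List (ℕ × Multigraph)
  | 0 => [(1, ⟨0, []⟩)]
  | r + 1 => mergeTypes ((types r).flatMap extensions)

/-- The weighted relabelling types of multigraphs with `r + 1` edges, none of which is isolated. -/
def nonisolatedTypes (r : ℕ) : List (ℕ × Multigraph) :=
  mergeTypes (((types r).flatMap extensions).filter fun x => ¬ x.2.HasIsolatedEdge)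

theorem nonisolatedTypes_zero : nonisolatedTypes 0 = [] := by
  decide

theorem nonisolatedTypes_one :
    nonisolatedTypes 1 = [(4, ⟨3, [(0, 1), (1, 2)]⟩), (2, ⟨2, [(0, 1), (0, 1)]⟩)] := by
  decide +kernel

theorem nonisolatedTypes_three :
    nonisolatedTypes 3 =
      [(192, ⟨4, [(0, 1), (1, 2), (0, 2), (2, 3)]⟩), (96, ⟨3, [(0, 1), (1, 2), (0, 2), (1, 2)]⟩),
        (192, ⟨5, [(0, 1), (1, 2), (1, 3), (3, 4)]⟩), (16, ⟨5, [(0, 1), (1, 2), (1, 3), (1, 4)]⟩),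
        (96, ⟨4, [(0, 1), (1, 2), (1, 3), (1, 3)]⟩), (192, ⟨5, [(0, 1), (1, 2), (2, 3), (3, 4)]⟩),
        (192, ⟨4, [(0, 1), (1, 2), (2, 3), (2, 3)]⟩), (48, ⟨4, [(0, 1), (1, 2), (2, 3), (0, 3)]⟩),
        (96, ⟨4, [(0, 1), (1, 2), (2, 3), (1, 2)]⟩), (48, ⟨6, [(0, 1), (1, 2), (3, 4), (4, 5)]⟩),
        (48, ⟨5, [(0, 1), (1, 2), (3, 4), (3, 4)]⟩), (64, ⟨3, [(0, 1), (0, 1), (0, 1), (1, 2)]⟩),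
        (8, ⟨2, [(0, 1), (0, 1), (0, 1), (0, 1)]⟩), (48, ⟨3, [(0, 1), (0, 1), (1, 2), (1, 2)]⟩),
        (12, ⟨4, [(0, 1), (0, 1), (2, 3), (2, 3)]⟩)] := by
  decide +kernel

/-- The sum of `F` over a list of weighted graphs. -/
def weightedSum (F : Multigraph → ℝ) (l : List (ℕ × Multigraph)) : ℝ :=
  (l.map fun x => x.1 * F x.2).sum

section WeightedSum

variable {F : Multigraph → ℝ} {l : List (ℕ × Multigraph)}

theorem mem_insertType {x y : ℕ × Multigraph} (hy : y ∈ insertType x l) :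
    y.2 = x.2 ∨ ∃ z ∈ l, y.2 = z.2 := by
  induction l with
  | nil => exact Or.inl (congrArg Prod.snd (List.mem_singleton.mp hy))
  | cons z l ih =>
    rw [insertType] at hy
    split_ifs at hy
    · rcases List.mem_cons.mp hy with rfl | hy
      · exact Or.inr ⟨z, List.mem_cons_self, rfl⟩
      · exact Or.inr ⟨y, List.mem_cons_of_mem _ hy, rfl⟩
    · rcases List.mem_cons.mp hy with rfl | hy
      · exact Or.inr ⟨y, List.mem_cons_self, rfl⟩
      · exact (ih hy).imp_right fun ⟨t, ht, hyt⟩ => ⟨t, List.mem_cons_of_mem _ ht, hyt⟩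

theorem mem_mergeTypes {y : ℕ × Multigraph} (hy : y ∈ mergeTypes l) : ∃ z ∈ l, y.2 = z.2 := by
  induction l generalizing y with
  | nil => exact absurd hy List.not_mem_nil
  | cons x l ih =>
    rcases mem_insertType hy with hyx | ⟨z, hz, hyz⟩
    · exact ⟨x, List.mem_cons_self, hyx⟩
    · obtain ⟨t, ht, hzt⟩ := ih hz
      exact ⟨t, List.mem_cons_of_mem _ ht, hyz.trans hzt⟩

theorem weightedSum_insertType {x : ℕ × Multigraph}
    (hF : ∀ y ∈ l, x.2.IsRelabelling y.2 → F x.2 = F y.2) :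
    weightedSum F (insertType x l) = x.1 * F x.2 + weightedSum F l := by
  induction l with
  | nil => rfl
  | cons y l ih =>
    rw [insertType]
    split_ifs with hxy
    · simp only [weightedSum, List.map_cons, List.sum_cons, Nat.cast_add,
        hF y List.mem_cons_self hxy]
      ring
    · have ih := ih fun z hz => hF z (List.mem_cons_of_mem _ hz)
      simp only [weightedSum, List.map_cons, List.sum_cons] at ih ⊢
      rw [ih, add_left_comm]

theorem weightedSum_mergeTypes
    (hF : ∀ x ∈ l, ∀ y ∈ l, x.2.IsRelabelling y.2 → F x.2 = F y.2) :
    weightedSum F (mergeTypes l) = weightedSum F l := by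
  induction l with
  | nil => rfl
  | cons x l ih =>
    have ih := ih fun y hy z hz =>
      hF y (List.mem_cons_of_mem _ hy) z (List.mem_cons_of_mem _ hz)
    refine (weightedSum_insertType fun y hy hxy => ?_).trans (congrArg (_ + ·) ih)
    obtain ⟨z, hz, hyz⟩ := mem_mergeTypes hy
    rw [hyz] at hxy ⊢
    exact hF x List.mem_cons_self z (List.mem_cons_of_mem _ hz) hxy

theorem weightedSum_congr {G : Multigraph → ℝ} (hFG : ∀ x ∈ l, F x.2 = G x.2) :
    weightedSum F l = weightedSum G l :=
  congrArg List.sum <| List.map_congr_left fun x hx => by rw [hFG x hx]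

theorem weightedSum_filter {p : ℕ × Multigraph → Bool} (hF : ∀ x ∈ l, p x = false → F x.2 = 0) :
    weightedSum F (l.filter p) = weightedSum F l := by
  induction l with
  | nil => rfl
  | cons x l ih =>
    have ih := ih fun y hy => hF y (List.mem_cons_of_mem _ hy)
    simp only [weightedSum, List.map_cons, List.sum_cons] at ih ⊢
    cases hpx : p x with
    | false =>
      rw [List.filter_cons_of_neg (by simp [hpx]), ih, hF x List.mem_cons_self hpx, mul_zero,
        zero_add]
    | true => rw [List.filter_cons_of_pos hpx, List.map_cons, List.sum_cons, ih]

theorem weightedSum_flatMap {g : ℕ × Multigraph → List (ℕ × Multigraph)} {G : Multigraph → ℝ}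
    (hg : ∀ x ∈ l, weightedSum F (g x) = x.1 * G x.2) :
    weightedSum F (l.flatMap g) = weightedSum G l := by
  induction l with
  | nil => rfl
  | cons x l ih =>
    have ih := ih fun y hy => hg y (List.mem_cons_of_mem _ hy)
    have hx := hg x List.mem_cons_self
    simp only [weightedSum, List.flatMap_cons, List.map_append, List.sum_append, List.map_cons,
      List.sum_cons] at ih hx ⊢
    rw [hx, ih]

theorem weightedSum_extensions (w : ℕ) (G : Multigraph) :
    weightedSum F (extensions (w, G)) = w *
      (2 * ∑ l ∈ Finset.range G.order, ∑ k ∈ Finset.range l,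
          F ⟨G.order, G.edges ++ [(k, l)]⟩ +
        2 * ∑ k ∈ Finset.range G.order, F ⟨G.order + 1, G.edges ++ [(k, G.order)]⟩ +
        F ⟨G.order + 2, G.edges ++ [(G.order, G.order + 1)]⟩) := by
  have hsum : ∀ (m : ℕ) (f : ℕ → ℝ), ((List.range m).map f).sum = ∑ i ∈ Finset.range m, f i :=
    fun _ _ => rfl
  simp only [weightedSum, extensions, List.map_append, List.sum_append,
    List.map_map, List.flatMap_def, List.map_flatten, List.sum_flatten, Function.comp_def, hsum,
    List.map_cons, List.map_nil, List.sum_singleton, Nat.cast_mul, Nat.cast_ofNat, ← Finset.mul_sum]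
  ring

end WeightedSum

theorem isWellFormed_of_mem_extensions {w : ℕ} {G : Multigraph} (hG : G.IsWellFormed)
    {y : ℕ × Multigraph} (hy : y ∈ extensions (w, G)) : y.2.IsWellFormed := by
  have happend : ∀ {v a b : ℕ}, G.order ≤ v → a < b → b < v →
      IsWellFormed ⟨v, G.edges ++ [(a, b)]⟩ := by
    intro v a b hv hab hb e he
    rcases List.mem_append.mp he with he | he
    · exact ⟨(hG e he).1, (hG e he).2.trans_le hv⟩
    · obtain rfl := List.mem_singleton.mp he
      exact ⟨hab, hb⟩
  simp only [extensions, List.mem_append, List.mem_flatMap, List.mem_map, List.mem_range,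
    List.mem_singleton] at hy
  rcases hy with (⟨l, hl, k, hk, rfl⟩ | ⟨k, hk, rfl⟩) | rfl
  · exact happend le_rfl hk hl
  · exact happend (Nat.le_succ _) hk (Nat.lt_succ_self _)
  · exact happend (Nat.le_add_right ..) (Nat.lt_succ_self _) (Nat.lt_succ_self _)

theorem isWellFormed_of_mem_types {r : ℕ} {x : ℕ × Multigraph} (hx : x ∈ types r) :
    x.2.IsWellFormed := by
  induction r generalizing x with
  | zero =>
    rw [List.mem_singleton.mp hx]
    exact fun e he => absurd he List.not_mem_nil
  | succ r ih =>
    obtain ⟨z, hz, hxz⟩ := mem_mergeTypes hx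
    obtain ⟨y, hy, hzy⟩ := List.mem_flatMap.mp hz
    exact hxz ▸ isWellFormed_of_mem_extensions (ih hy) hzy

theorem isWellFormed_of_mem_flatMap_extensions {r : ℕ} {x : ℕ × Multigraph}
    (hx : x ∈ (types r).flatMap extensions) : x.2.IsWellFormed := by
  obtain ⟨y, hy, hxy⟩ := List.mem_flatMap.mp hx
  exact isWellFormed_of_mem_extensions (isWellFormed_of_mem_types hy) hxy

end Multigraph

section PairSum

/-- The sum of a kernel over all ordered pairs of distinct entries of a sample. -/
def pairSum {ι α : Type*} [Fintype ι] (h : α → α → ℝ) (z : ι → α) : ℝ :=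
  ∑ e ∈ Finset.univ.offDiag, h (z e.1) (z e.2)

/-- The product of a kernel over a list of pairs of entries of a sample. -/
def edgeProd {α : Type*} (h : α → α → ℝ) (L : List (ℕ × ℕ)) (z : ℕ → α) : ℝ :=
  (L.map fun e => h (z e.1) (z e.2)).prod

theorem pairSum_comp {ι κ α : Type*} [Fintype ι] [Fintype κ] (h : α → α → ℝ)
    (z : κ → α) (e : ι ≃ κ) : pairSum h (z ∘ e) = pairSum h z := by
  refine Finset.sum_equiv (e.prodCongr e) (fun i => ?_) fun i _ => rfl
  simp

section EdgeProd

variable {α : Type*} {h : α → α → ℝ} {L L' : List (ℕ × ℕ)}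

theorem edgeProd_comp (f : ℕ → ℕ) (z : ℕ → α) :
    edgeProd h L (z ∘ f) = edgeProd h (L.map (Prod.map f f)) z := by
  rw [edgeProd, edgeProd, List.map_map]
  rfl

theorem edgeProd_append_singleton (e : ℕ × ℕ) (z : ℕ → α) :
    edgeProd h (L ++ [e]) z = edgeProd h L z * h (z e.1) (z e.2) := by
  rw [edgeProd, List.map_append, List.prod_append, List.map_singleton, List.prod_singleton]
  rfl

theorem edgeProd_congr {y z : ℕ → α} (hyz : ∀ e ∈ L, y e.1 = z e.1 ∧ y e.2 = z e.2) :
    edgeProd h L y = edgeProd h L z :=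
  congrArg List.prod <| List.map_congr_left fun e he => by rw [(hyz e he).1, (hyz e he).2]

theorem edgeProd_eq_of_perm (hsymm : ∀ a b, h a b = h b a)
    (hL : (L.map fun e => s(e.1, e.2)).Perm (L'.map fun e => s(e.1, e.2))) (z : ℕ → α) :
    edgeProd h L z = edgeProd h L' z := by
  let g : Sym2 ℕ → ℝ := Sym2.lift ⟨fun i j => h (z i) (z j), fun _ _ => hsymm _ _⟩
  have hg : ∀ L : List (ℕ × ℕ), edgeProd h L z = ((L.map fun e => s(e.1, e.2)).map g).prod :=
    fun L => by
      rw [edgeProd, List.map_map]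
      rfl
  rw [hg, hg, (hL.map g).prod_eq]

theorem dependsOn_edgeProd {v : ℕ} (hL : ∀ e ∈ L, e.1 < e.2 ∧ e.2 < v) :
    DependsOn (edgeProd h L) (Set.Iio v) := fun _ _ hyz =>
  edgeProd_congr fun e he => ⟨hyz _ ((hL e he).1.trans (hL e he).2), hyz _ (hL e he).2⟩

theorem dependsOn_pairSum {n : ℕ} (r : ℕ) :
    DependsOn (fun z : ℕ → α => pairSum h (fun i : Fin n => z i) ^ r) (Set.Iio n) :=
  fun y z hyz => by
    have : (fun i : Fin n => y i) = fun i : Fin n => z i := funext fun i => hyz i i.2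
    simp only [this]

end EdgeProd

section TriangularSums

variable {f : ℕ → ℕ → ℝ}

theorem sum_offDiag_fin (hf : ∀ i j, f i j = f j i) (n : ℕ) :
    ∑ e ∈ (Finset.univ : Finset (Fin n)).offDiag, f e.1 e.2 =
      2 * ∑ l ∈ Finset.range n, ∑ k ∈ Finset.range l, f k l := by
  have hite : ∑ e ∈ (Finset.univ : Finset (Fin n)).offDiag, f e.1 e.2 =
      ∑ i ∈ Finset.range n, ∑ j ∈ Finset.range n, if i = j then 0 else f i j := by
    have hfilter : (Finset.univ : Finset (Fin n)).offDiag =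
        Finset.univ.filter fun e : Fin n × Fin n => e.1 ≠ e.2 := by
      ext e
      simp only [Finset.mem_offDiag, Finset.mem_univ, Finset.mem_filter, true_and]
    rw [hfilter, Finset.sum_filter, Fintype.sum_prod_type]
    simp only [Finset.sum_range, Fin.val_inj, ite_not]
  rw [hite]
  clear hite
  induction n with
  | zero => simp only [Finset.range_zero, Finset.sum_empty, mul_zero]
  | succ n ih =>
    have hlt : ∀ g : ℕ → ℝ, ∑ i ∈ Finset.range n, (if i = n then 0 else g i) =
        ∑ i ∈ Finset.range n, g i := fun g =>
      Finset.sum_congr rfl fun i hi => if_neg (Finset.mem_range.mp hi).ne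
    simp only [Finset.sum_range_succ, Finset.sum_add_distrib, ih, hlt, eq_comm (a := n), hf n,
      if_true]
    ring

theorem sum_triangle_eq {v n : ℕ} (hvn : v ≤ n)
    (hone : ∀ k l, k < v → v ≤ l → l < n → f k l = f k v)
    (htwo : ∀ k l, v ≤ k → k < l → l < n → f k l = f v (v + 1)) :
    2 * ∑ l ∈ Finset.range n, ∑ k ∈ Finset.range l, f k l =
      2 * ∑ l ∈ Finset.range v, ∑ k ∈ Finset.range l, f k l +
        (n - v) * (2 * ∑ k ∈ Finset.range v, f k v) + (n - v) * (n - v - 1) * f v (v + 1) := by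
  induction n, hvn using Nat.le_induction with
  | base => ring
  | succ n hvn ih =>
    have hrow : ∑ k ∈ Finset.range n, f k n =
        ∑ k ∈ Finset.range v, f k v + (n - v) * f v (v + 1) := by
      rw [← Finset.sum_range_add_sum_Ico _ hvn]
      congr 1
      · exact Finset.sum_congr rfl fun k hk =>
          hone k n (Finset.mem_range.mp hk) hvn n.lt_succ_self
      · rw [Finset.sum_congr rfl fun k hk => htwo k n (Finset.mem_Ico.mp hk).1
          (Finset.mem_Ico.mp hk).2 n.lt_succ_self, Finset.sum_const, Nat.card_Ico, nsmul_eq_mul,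
          Nat.cast_sub hvn]
    rw [Finset.sum_range_succ, mul_add, hrow,
      ih (fun k l hk hl hln => hone k l hk hl (hln.trans n.lt_succ_self))
        fun k l hk hkl hln => htwo k l hk hkl (hln.trans n.lt_succ_self)]
    push_cast
    ring

end TriangularSums

section Moments

variable {α : Type*} [Fintype α] [Inhabited α] {h : α → α → ℝ} {n r : ℕ} {L : List (ℕ × ℕ)}

/-- The joint moment of the kernel along the edges of a graph, times the `r`-th power of its pair
sum over `n` samples. -/
def mixedMoment (h : α → α → ℝ) (n r : ℕ) (L : List (ℕ × ℕ)) : ℝ :=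
  sampleMean n fun z => edgeProd h L z * pairSum h (fun i : Fin n => z i) ^ r

theorem mixedMoment_map (hL : ∀ e ∈ L, e.1 < e.2 ∧ e.2 < n) {f : ℕ → ℕ}
    (hinj : Set.InjOn f (Set.Iio n)) (hmaps : Set.MapsTo f (Set.Iio n) (Set.Iio n)) :
    mixedMoment h n r (L.map (Prod.map f f)) = mixedMoment h n r L := by
  let g : Fin n → Fin n := fun i => ⟨f i, hmaps i.2⟩
  have hg : g.Bijective := Finite.injective_iff_bijective.mp fun i j hij =>
    Fin.ext (hinj i.2 j.2 (congrArg Fin.val hij))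
  rw [mixedMoment, mixedMoment, ← sampleMean_comp hinj hmaps
    (F := fun z => edgeProd h L z * pairSum h (fun i : Fin n => z i) ^ r)
    fun y z hyz => congrArg₂ (· * ·) (dependsOn_edgeProd hL hyz) (dependsOn_pairSum r hyz)]
  congr! 2 with z
  rw [← edgeProd_comp, ← pairSum_comp h (fun i : Fin n => z i) (Equiv.ofBijective g hg)]
  rfl

theorem mixedMoment_eq_of_perm (hsymm : ∀ a b, h a b = h b a) {L' : List (ℕ × ℕ)}
    (hL : (L.map fun e => s(e.1, e.2)).Perm (L'.map fun e => s(e.1, e.2))) :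
    mixedMoment h n r L = mixedMoment h n r L' := by
  simp only [mixedMoment, edgeProd_eq_of_perm hsymm hL]

theorem mixedMoment_append_map {G : Multigraph} (hG : G.IsWellFormed) (hGn : G.order ≤ n)
    (σ : Equiv.Perm ℕ) (hσn : ∀ i, n ≤ i → σ i = i) (hσG : ∀ i < G.order, σ i = i) {k l : ℕ}
    (hkl : k < l) (hl : l < n) :
    mixedMoment h n r (G.edges ++ [(σ k, σ l)]) = mixedMoment h n r (G.edges ++ [(k, l)]) := by
  have hwf : ∀ e ∈ G.edges ++ [(k, l)], e.1 < e.2 ∧ e.2 < n := fun e he => by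
    rcases List.mem_append.mp he with he | he
    · exact ⟨(hG e he).1, (hG e he).2.trans_le hGn⟩
    · obtain rfl := List.mem_singleton.mp he
      exact ⟨hkl, hl⟩
  have hmaps : Set.MapsTo σ (Set.Iio n) (Set.Iio n) := fun i hi => by
    by_contra hσi
    have := σ.injective (hσn _ (not_lt.mp hσi))
    exact hσi (this.symm ▸ hi)
  rw [← mixedMoment_map hwf σ.injective.injOn hmaps, List.map_append, List.map_congr_left,
    List.map_id]
  · rfl
  · exact fun e he => Prod.ext (hσG _ ((hG e he).1.trans (hG e he).2)) (hσG _ (hG e he).2)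

theorem mixedMoment_succ (hsymm : ∀ a b, h a b = h b a) (L : List (ℕ × ℕ)) :
    mixedMoment h n (r + 1) L = 2 * ∑ l ∈ Finset.range n, ∑ k ∈ Finset.range l,
      mixedMoment h n r (L ++ [(k, l)]) := by
  rw [← sum_offDiag_fin fun i j => mixedMoment_eq_of_perm hsymm _]
  · simp only [mixedMoment, sampleMean, ← Finset.expect_sum_comm, edgeProd_append_singleton]
    refine Finset.expect_congr rfl fun z _ => ?_
    rw [pow_succ', pairSum, ← mul_assoc, Finset.mul_sum, Finset.sum_mul]
  · intro i j
    simp only [List.map_append, List.map_singleton, Sym2.eq_swap]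
    rfl

/-- The mixed moment weighted by the number of ways of placing the vertices of the graph among the
samples. -/
def weightedMoment (h : α → α → ℝ) (n r : ℕ) (G : Multigraph) : ℝ :=
  n.descFactorial G.order * mixedMoment h n r G.edges

theorem Multigraph.IsRelabelling.exists_map {G H : Multigraph} (hG : G.IsWellFormed)
    (hGH : G.IsRelabelling H) (hn : G.order ≤ n) :
    ∃ f : ℕ → ℕ, Set.InjOn f (Set.Iio n) ∧ Set.MapsTo f (Set.Iio n) (Set.Iio n) ∧
      ((G.edges.map (Prod.map f f)).map fun e => s(e.1, e.2)).Perm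
        (H.edges.map fun e => s(e.1, e.2)) := by
  obtain ⟨-, σ, hσ, hperm⟩ := hGH
  rw [List.mem_permutations'] at hσ
  have hlength : σ.length = G.order := hσ.length_eq.trans List.length_range
  have hmem : ∀ i < G.order, σ.getD i 0 < G.order := fun i hi => by
    rw [List.getD_eq_getElem σ 0 (hlength ▸ hi)]
    exact List.mem_range.mp (hσ.subset (List.getElem_mem _))
  have hinj : ∀ i < G.order, ∀ j < G.order, σ.getD i 0 = σ.getD j 0 → i = j :=
    fun i hi j hj hij => by
      rw [List.getD_eq_getElem σ 0 (hlength ▸ hi), List.getD_eq_getElem σ 0 (hlength ▸ hj)] at hij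
      exact (hσ.nodup_iff.mpr List.nodup_range).getElem_inj_iff.mp hij
  refine ⟨fun i => if i < G.order then σ.getD i 0 else i, fun i _ j _ hij => ?_,
    fun i hi => ?_, ?_⟩
  · simp only at hij
    split_ifs at hij with hiG hjG hjG
    · exact hinj i hiG j hjG hij
    · exact absurd (hij ▸ hmem i hiG) hjG
    · exact absurd (hij ▸ hmem j hjG) hiG
    · exact hij
  · simp only [Set.mem_Iio]
    split_ifs with hiG
    · exact (hmem i hiG).trans_le hn
    · exact hi
  · convert hperm using 1
    rw [List.map_map]
    refine List.map_congr_left fun e he => ?_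
    rw [Function.comp_apply, Prod.map_fst, Prod.map_snd, if_pos (hG e he).2,
      if_pos ((hG e he).1.trans (hG e he).2)]

theorem weightedMoment_eq_of_isRelabelling (hsymm : ∀ a b, h a b = h b a) {G H : Multigraph}
    (hG : G.IsWellFormed) (hGH : G.IsRelabelling H) :
    weightedMoment h n r G = weightedMoment h n r H := by
  rw [weightedMoment, weightedMoment, ← hGH.1]
  rcases lt_or_ge n G.order with hn | hn
  · simp only [Nat.descFactorial_of_lt hn, Nat.cast_zero, zero_mul]
  obtain ⟨f, hinj, hmaps, hperm⟩ := hGH.exists_map hG hn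
  rw [← mixedMoment_map (fun e he => ⟨(hG e he).1, (hG e he).2.trans_le hn⟩) hinj hmaps,
    mixedMoment_eq_of_perm hsymm hperm]

theorem cast_descFactorial_succ (n k : ℕ) :
    (n.descFactorial (k + 1) : ℝ) = (n - k) * n.descFactorial k := by
  rcases le_or_gt k n with hk | hk
  · rw [Nat.descFactorial_succ, Nat.cast_mul, Nat.cast_sub hk]
  · rw [Nat.descFactorial_of_lt hk, Nat.descFactorial_of_lt (hk.trans k.lt_succ_self),
      Nat.cast_zero, mul_zero]

theorem weightedSum_weightedMoment_extensions (hsymm : ∀ a b, h a b = h b a) (w : ℕ)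
    {G : Multigraph} (hG : G.IsWellFormed) :
    Multigraph.weightedSum (weightedMoment h n r) (Multigraph.extensions (w, G)) =
      w * weightedMoment h n (r + 1) G := by
  rw [Multigraph.weightedSum_extensions]
  congr 1
  simp only [weightedMoment, cast_descFactorial_succ, ← Finset.mul_sum, Nat.cast_add, Nat.cast_one]
  rcases lt_or_ge n G.order with hn | hn
  · simp only [Nat.descFactorial_of_lt hn, Nat.cast_zero, zero_mul, mul_zero, add_zero]
  rw [mixedMoment_succ hsymm, sum_triangle_eq hn]
  · ring
  · intro k l hk hl hln
    rw [← mixedMoment_append_map hG hn (Equiv.swap G.order l)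
      (fun i hi => Equiv.swap_apply_of_ne_of_ne (by lia) (by lia))
      (fun i hi => Equiv.swap_apply_of_ne_of_ne (by lia) (by lia)) (hk.trans_le hl) hln,
      Equiv.swap_apply_right, Equiv.swap_apply_of_ne_of_ne (by lia) (by lia)]
  · intro k l hk hkl hln
    rw [← mixedMoment_append_map hG hn (Equiv.swap G.order k * Equiv.swap (G.order + 1) l)
      (fun i hi => ?_) (fun i hi => ?_) G.order.lt_succ_self (by lia), Equiv.Perm.mul_apply,
      Equiv.Perm.mul_apply, Nat.succ_eq_add_one, Equiv.swap_apply_left (G.order + 1),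
      Equiv.swap_apply_of_ne_of_ne (a := G.order + 1) (by lia) (by lia),
      Equiv.swap_apply_left, Equiv.swap_apply_of_ne_of_ne (by lia) (by lia)]
    all_goals
      rw [Equiv.Perm.mul_apply, Equiv.swap_apply_of_ne_of_ne (a := G.order + 1) (by lia) (by lia),
        Equiv.swap_apply_of_ne_of_ne (by lia) (by lia)]

theorem expect_pairSum_pow_eq_weightedSum_types (hsymm : ∀ a b, h a b = h b a) (n r s : ℕ) :
    𝔼 z : Fin n → α, pairSum h z ^ (r + s) =
      Multigraph.weightedSum (weightedMoment h n r) (Multigraph.types s) := by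
  induction s generalizing r with
  | zero =>
    simp only [Multigraph.weightedSum, Multigraph.types, List.map_singleton, List.sum_singleton,
      weightedMoment, mixedMoment, sampleMean, edgeProd, List.map_nil, List.prod_nil,
      Nat.descFactorial_zero, Nat.cast_one, one_mul, extend_val_apply, add_zero]
  | succ s ih =>
    rw [Multigraph.types, Multigraph.weightedSum_mergeTypes fun x hx y _ hxy => ?_,
      Multigraph.weightedSum_flatMap fun x hx => weightedSum_weightedMoment_extensions hsymm x.1
        (Multigraph.isWellFormed_of_mem_types hx), ← ih, add_right_comm, add_assoc]
    exact weightedMoment_eq_of_isRelabelling hsymm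
      (Multigraph.isWellFormed_of_mem_flatMap_extensions hx) hxy

theorem sampleMean_edgeProd_eq_zero (hmean : 𝔼 a, 𝔼 b, h a b = 0) {G : Multigraph}
    (hG : G.IsWellFormed) (hisolated : G.HasIsolatedEdge) (hn : G.order ≤ n) :
    sampleMean n (edgeProd h G.edges) = 0 := by
  obtain ⟨e, he, hdisj⟩ := hisolated
  have hdep : DependsOn (edgeProd h G.edges) (Set.Iio n) :=
    dependsOn_edgeProd fun f hf => ⟨(hG f hf).1, (hG f hf).2.trans_le hn⟩
  have hsplit : ∀ (z : ℕ → α) (a b : α),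
      edgeProd h G.edges (Function.update (Function.update z e.1 a) e.2 b) =
        edgeProd h (G.edges.erase e) z * h a b := by
    intro z a b
    rw [edgeProd, ((List.perm_cons_erase he).map _).prod_eq, List.map_cons, List.prod_cons,
      Function.update_self, Function.update_of_ne (hG e he).1.ne, Function.update_self, mul_comm]
    refine congrArg (· * h a b) (edgeProd_congr fun f hf => ?_)
    obtain ⟨h11, h12, h21, h22⟩ := hdisj f hf
    simp only [Function.update_of_ne, ne_eq, h11, h12, h21, h22, not_false_eq_true, and_self]
  rw [← sampleMean_update e.2 hdep, ← sampleMean_update e.1]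
  · simp only [hsplit, ← Finset.mul_expect, hmean, mul_zero]
    exact Finset.expect_const_zero _
  · intro y z hyz
    refine Finset.expect_congr rfl fun b _ => hdep fun i hi => ?_
    rcases eq_or_ne i e.2 with rfl | hie
    · rw [Function.update_self, Function.update_self]
    · rw [Function.update_of_ne hie, Function.update_of_ne hie, hyz i hi]

/-- The mean of the product of the kernel over the edges of a graph whose vertices are independent
uniform samples. -/
def graphMean (h : α → α → ℝ) (G : Multigraph) : ℝ :=
  sampleMean G.order (edgeProd h G.edges)

theorem weightedMoment_zero {G : Multigraph} (hG : G.IsWellFormed) :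
    weightedMoment h n 0 G = n.descFactorial G.order * graphMean h G := by
  rcases lt_or_ge n G.order with hn | hn
  · rw [weightedMoment, Nat.descFactorial_of_lt hn, Nat.cast_zero, zero_mul, zero_mul]
  · simp only [weightedMoment, mixedMoment, pow_zero, mul_one, graphMean]
    rw [sampleMean_eq_of_dependsOn hn (dependsOn_edgeProd hG)]

theorem expect_pairSum_pow_succ (hsymm : ∀ a b, h a b = h b a) (hmean : 𝔼 a, 𝔼 b, h a b = 0)
    (n r : ℕ) :
    𝔼 z : Fin n → α, pairSum h z ^ (r + 1) =
      Multigraph.weightedSum (fun G => n.descFactorial G.order * graphMean h G)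
        (Multigraph.nonisolatedTypes r) := by
  have hwf : ∀ x ∈ (Multigraph.types r).flatMap Multigraph.extensions, x.2.IsWellFormed :=
    fun x hx => Multigraph.isWellFormed_of_mem_flatMap_extensions hx
  have hinvariant : ∀ x ∈ (Multigraph.types r).flatMap Multigraph.extensions,
      ∀ y ∈ (Multigraph.types r).flatMap Multigraph.extensions, x.2.IsRelabelling y.2 →
        n.descFactorial x.2.order * graphMean h x.2 =
          n.descFactorial y.2.order * graphMean h y.2 := fun x hx y hy hxy => by
    rw [← weightedMoment_zero (hwf x hx), ← weightedMoment_zero (hwf y hy),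
      weightedMoment_eq_of_isRelabelling hsymm (hwf x hx) hxy]
  rw [add_comm, expect_pairSum_pow_eq_weightedSum_types hsymm,
    ← Multigraph.weightedSum_flatMap fun x hx => weightedSum_weightedMoment_extensions hsymm x.1
      (Multigraph.isWellFormed_of_mem_types hx),
    Multigraph.weightedSum_congr (G := fun G => n.descFactorial G.order * graphMean h G)
      fun x hx => weightedMoment_zero (hwf x hx),
    Multigraph.nonisolatedTypes, Multigraph.weightedSum_mergeTypes, Multigraph.weightedSum_filter]
  · intro x hx hisolated
    rw [graphMean, sampleMean_edgeProd_eq_zero hmean (hwf x hx) _ le_rfl, mul_zero]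
    simpa using hisolated
  · exact fun x hx y hy => hinvariant x (List.mem_of_mem_filter hx) y (List.mem_of_mem_filter hy)

end Moments

end PairSum

section OrdSign

/-- The kernel `sign (a - b)` of a linear order. -/
def ordSign {α : Type*} [LinearOrder α] (a b : α) : ℝ :=
  if b < a then 1 else if a < b then -1 else 0

section LinearOrder

variable {α : Type*} [LinearOrder α]

theorem ordSign_self (a : α) : ordSign a a = 0 := by
  simp only [ordSign, lt_self_iff_false, if_false]

theorem ordSign_swap (a b : α) : ordSign a b = -ordSign b a := by
  grind [ordSign]

theorem ordSign_sq (a b : α) : ordSign a b ^ 2 = 1 - if b = a then 1 else 0 := by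
  grind [ordSign]

theorem ordSign_mul_mul_self (a b : α) (x : ℝ) :
    ordSign a b * (ordSign a b * (ordSign a b * x)) = ordSign a b * x := by
  grind [ordSign]

theorem abs_ordSign_le_one (a b : α) : |ordSign a b| ≤ 1 := by
  grind [ordSign]

theorem sum_ordSign_mul_ordSign (a b c : α) :
    ordSign a b * ordSign a c + ordSign b a * ordSign b c + ordSign c a * ordSign c b =
      1 - (if c = a then 1 else 0) * (if b = a then 1 else 0) := by
  grind [ordSign]

end LinearOrder

variable {q : ℕ}

/-- The rank of `a` among the `q` values of `Fin q`, centred and scaled so that it equals the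
average of `ordSign a`. -/
def centredRank (a : Fin q) : ℝ := (2 * a - q + 1) / q

/-- Summation by parts: `ordSign a` has jumps at `a` and `a + 1` only. -/
theorem expect_ordSign_mul_sub (a : Fin q) (F : ℕ → ℝ) :
    𝔼 b : Fin q, ordSign a b * (F (b + 1) - F b) = (F a + F (a + 1) - F 0 - F q) / q := by
  have hsign : ∀ b : Fin q, ordSign a b * (F (b + 1) - F b) =
      (F (min (b + 1) a) - F (min b a)) - (F (max (b + 1) (a + 1)) - F (max b (a + 1))) := by
    intro b
    rcases lt_trichotomy (a : ℕ) b with h | h | h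
    · grind [ordSign]
    · grind [ordSign]
    · grind [ordSign]
  rw [Fintype.expect_eq_sum_div_card, Fintype.card_fin, Finset.sum_congr rfl fun b _ => hsign b,
    Finset.sum_sub_distrib, Fin.sum_univ_eq_sum_range fun b => F (min (b + 1) a) - F (min b a),
    Finset.sum_range_sub fun b => F (min b a),
    Fin.sum_univ_eq_sum_range fun b => F (max (b + 1) (a + 1)) - F (max b (a + 1)),
    Finset.sum_range_sub fun b => F (max b (a + 1)), min_eq_right a.2.le, max_eq_left a.2,
    Nat.zero_min, Nat.zero_max]
  ring

theorem expect_fin_sub (F : ℕ → ℝ) :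
    𝔼 a : Fin q, (F (a + 1) - F a) = (F q - F 0) / q := by
  rw [Fintype.expect_eq_sum_div_card, Fintype.card_fin,
    Fin.sum_univ_eq_sum_range fun a => F (a + 1) - F a, Finset.sum_range_sub]

theorem expect_expect_eq_zero_of_antisymm {α : Type*} [Fintype α] {f : α → α → ℝ}
    (hf : ∀ a b, f a b = -f b a) : 𝔼 a, 𝔼 b, f a b = 0 := by
  refine self_eq_neg.mp ((Finset.expect_comm ..).trans ?_)
  simp only [← Finset.expect_neg_distrib, ← hf]

theorem expect_ordSign (a : Fin q) : 𝔼 b, ordSign a b = centredRank a := by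
  rw [← mul_one (centredRank a)]
  refine (Finset.expect_congr rfl fun b _ => ?_).trans
    ((expect_ordSign_mul_sub a fun b => b).trans ?_)
  · push_cast
    ring
  · push_cast [centredRank]
    ring

theorem expect_ordSign_right (b : Fin q) : 𝔼 a, ordSign a b = -centredRank b := by
  simp only [ordSign_swap _ b, Finset.expect_neg_distrib, expect_ordSign]

theorem expect_centredRank : 𝔼 a : Fin q, centredRank a = 0 := by
  simp only [← expect_ordSign, expect_expect_eq_zero_of_antisymm ordSign_swap]

theorem expect_ite_eq_mul (a : Fin q) (f : Fin q → ℝ) :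
    𝔼 b, (if b = a then 1 else 0) * f b = f a / q := by
  simp only [Fintype.expect_eq_sum_div_card, ite_mul, one_mul, zero_mul, Finset.sum_ite_eq',
    Finset.mem_univ, if_true, Fintype.card_fin]

section Moments

variable [NeZero q]

theorem expect_ordSign_sq (a : Fin q) : 𝔼 b, ordSign a b ^ 2 = 1 - 1 / (q : ℝ) := by
  simpa only [ordSign_sq, Finset.expect_sub_distrib, Fintype.expect_const, mul_one] using
    congrArg (1 - ·) (expect_ite_eq_mul a fun _ => 1)

theorem expect_ordSign_mul_ordSign (a b : Fin q) :
    𝔼 c, ordSign a c * ordSign b c =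
      1 - (if b = a then 1 else 0) / q - ordSign a b * (centredRank a - centredRank b) := by
  have hsum : ∀ c, ordSign a c * ordSign b c =
      1 - (if c = a then 1 else 0) * (if b = a then 1 else 0) - ordSign a b * ordSign a c +
        ordSign a b * ordSign b c := fun c => by
    rw [← sum_ordSign_mul_ordSign a b c, ordSign_swap c a, ordSign_swap c b, ordSign_swap b a]
    ring
  simp only [hsum, Finset.expect_add_distrib, Finset.expect_sub_distrib, ← Finset.mul_expect,
    expect_ordSign, Fintype.expect_const, expect_ite_eq_mul]
  ring

theorem expect_ordSign_mul_centredRank (a : Fin q) :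
    𝔼 b, ordSign a b * centredRank b = (centredRank a ^ 2 - (1 - 1 / (q : ℝ) ^ 2)) / 2 := by
  have hq := NeZero.ne (q : ℝ)
  refine (Finset.expect_congr rfl fun b _ => ?_).trans
    ((expect_ordSign_mul_sub a fun b => b * (b - q) / q).trans ?_)
  · push_cast [centredRank]
    field_simp
    ring
  · push_cast [centredRank]
    field_simp
    ring

theorem expect_centredRank_sq : 𝔼 a : Fin q, centredRank a ^ 2 = (1 - 1 / (q : ℝ) ^ 2) / 3 := by
  have hq := NeZero.ne (q : ℝ)
  refine (Finset.expect_congr rfl fun a _ => ?_).trans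
    ((expect_fin_sub fun a => ((2 * a - q) ^ 3 - (2 * a - q)) / (6 * q ^ 2)).trans ?_)
  · push_cast [centredRank]
    field_simp
    ring
  · push_cast
    field_simp
    ring

theorem expect_centredRank_pow_four :
    𝔼 a : Fin q, centredRank a ^ 4 = (1 - 1 / (q : ℝ) ^ 2) * (3 - 7 / q ^ 2) / 15 := by
  have hq := NeZero.ne (q : ℝ)
  refine (Finset.expect_congr rfl fun a _ => ?_).trans
    ((expect_fin_sub fun a =>
      (3 * (2 * a - q) ^ 5 - 10 * (2 * a - q) ^ 3 + 7 * (2 * a - q)) / (30 * q ^ 4)).trans ?_)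
  · push_cast [centredRank]
    field_simp
    ring
  · push_cast
    field_simp
    ring

end Moments

end OrdSign

section GraphMeans

variable {q : ℕ} [NeZero q]

theorem graphMean_ordSign_double_edge :
    graphMean (ordSign (α := Fin q)) ⟨2, [(0, 1), (0, 1)]⟩ = 1 - 1 / q := by
  simp only [graphMean, sampleMean_succ, sampleMean_zero]
  change 𝔼 a, 𝔼 b, ordSign a b * (ordSign a b * 1) = _
  simp only [mul_one, ← sq, expect_ordSign_sq, Fintype.expect_const]

theorem graphMean_ordSign_quadruple_edge :
    graphMean (ordSign (α := Fin q)) ⟨2, [(0, 1), (0, 1), (0, 1), (0, 1)]⟩ = 1 - 1 / q := by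
  simp only [graphMean, sampleMean_succ, sampleMean_zero]
  change 𝔼 a, 𝔼 b, ordSign a b * (ordSign a b * (ordSign a b * (ordSign a b * 1))) = _
  simp only [ordSign_mul_mul_self]
  simp only [mul_one, ← sq, expect_ordSign_sq, Fintype.expect_const]

theorem graphMean_ordSign_path_three :
    graphMean (ordSign (α := Fin q)) ⟨3, [(0, 1), (1, 2)]⟩ = -((1 - 1 / q ^ 2) / 3) := by
  simp only [graphMean, sampleMean_succ, sampleMean_zero]
  change 𝔼 a, 𝔼 b, 𝔼 c, ordSign a b * (ordSign b c * 1) = _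
  rw [Finset.expect_comm]
  simp only [mul_one, ← Finset.mul_expect, ← Finset.expect_mul, expect_ordSign,
    expect_ordSign_right, neg_mul, ← sq, Finset.expect_neg_distrib, expect_centredRank_sq]

theorem graphMean_ordSign_triple_edge_pendant :
    graphMean (ordSign (α := Fin q)) ⟨3, [(0, 1), (0, 1), (0, 1), (1, 2)]⟩ =
      -((1 - 1 / q ^ 2) / 3) := by
  simp only [graphMean, sampleMean_succ, sampleMean_zero]
  change 𝔼 a, 𝔼 b, 𝔼 c,
    ordSign a b * (ordSign a b * (ordSign a b * (ordSign b c * 1))) = _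
  rw [Finset.expect_comm]
  simp only [ordSign_mul_mul_self, mul_one, ← Finset.mul_expect, ← Finset.expect_mul,
    expect_ordSign, expect_ordSign_right, neg_mul, ← sq, Finset.expect_neg_distrib,
    expect_centredRank_sq]

theorem graphMean_ordSign_double_edges_path :
    graphMean (ordSign (α := Fin q)) ⟨3, [(0, 1), (0, 1), (1, 2), (1, 2)]⟩ = (1 - 1 / q) ^ 2 := by
  simp only [graphMean, sampleMean_succ, sampleMean_zero]
  change 𝔼 a, 𝔼 b, 𝔼 c,
    ordSign a b * (ordSign a b * (ordSign b c * (ordSign b c * 1))) = _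
  simp only [mul_one, ← sq, ← mul_assoc (ordSign _ _) (ordSign _ _), ← Finset.mul_expect,
    ← Finset.expect_mul, expect_ordSign_sq, Fintype.expect_const]

theorem graphMean_ordSign_double_edges_disjoint :
    graphMean (ordSign (α := Fin q)) ⟨4, [(0, 1), (0, 1), (2, 3), (2, 3)]⟩ = (1 - 1 / q) ^ 2 := by
  simp only [graphMean, sampleMean_succ, sampleMean_zero]
  change 𝔼 a, 𝔼 b, 𝔼 c, 𝔼 d,
    ordSign a b * (ordSign a b * (ordSign c d * (ordSign c d * 1))) = _
  simp only [mul_one, ← sq, ← mul_assoc (ordSign _ _) (ordSign _ _), ← Finset.mul_expect,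
    ← Finset.expect_mul, expect_ordSign_sq, Fintype.expect_const]

theorem graphMean_ordSign_doubled_triangle :
    graphMean (ordSign (α := Fin q)) ⟨3, [(0, 1), (1, 2), (0, 2), (1, 2)]⟩ =
      (1 - 1 / q ^ 2) / 3 - (1 - 1 / q) / q := by
  simp only [graphMean, sampleMean_succ, sampleMean_zero]
  change 𝔼 a, 𝔼 b, 𝔼 c,
    ordSign a b * (ordSign b c * (ordSign a c * (ordSign b c * 1))) = _
  have hsq : ∀ a b c : Fin q, ordSign a b * (ordSign b c * (ordSign a c * (ordSign b c * 1))) =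
      ordSign a b * ordSign a c - (if c = b then 1 else 0) * (ordSign a b * ordSign a c) :=
    fun a b c => by linear_combination ordSign a b * ordSign a c * ordSign_sq b c
  simp only [hsq, Finset.expect_sub_distrib, expect_ite_eq_mul, ← Finset.mul_expect,
    ← Finset.expect_mul, ← Finset.expect_div, expect_ordSign, ← sq, expect_ordSign_sq,
    expect_centredRank_sq, Fintype.expect_const]

theorem graphMean_ordSign_path_double_middle :
    graphMean (ordSign (α := Fin q)) ⟨4, [(0, 1), (1, 2), (2, 3), (1, 2)]⟩ =
      (1 - 1 / q ^ 2) / 3 / q := by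
  simp only [graphMean, sampleMean_succ, sampleMean_zero]
  change 𝔼 a, 𝔼 b, 𝔼 c, 𝔼 d,
    ordSign a b * (ordSign b c * (ordSign c d * (ordSign b c * 1))) = _
  have hsq : ∀ a b c d : Fin q,
      ordSign a b * (ordSign b c * (ordSign c d * (ordSign b c * 1))) =
        ordSign a b * ordSign c d - (if c = b then 1 else 0) * (ordSign a b * ordSign c d) :=
    fun a b c d => by linear_combination ordSign a b * ordSign c d * ordSign_sq b c
  rw [Finset.expect_comm]
  simp only [hsq, Finset.expect_sub_distrib, expect_ite_eq_mul, ← Finset.mul_expect,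
    ← Finset.expect_mul, ← Finset.expect_div, expect_ordSign, expect_ordSign_right,
    expect_centredRank, neg_mul, ← sq, Finset.expect_neg_distrib, expect_centredRank_sq]
  ring

theorem graphMean_ordSign_path_double_end :
    graphMean (ordSign (α := Fin q)) ⟨4, [(0, 1), (1, 2), (2, 3), (2, 3)]⟩ =
      -((1 - 1 / q) * ((1 - 1 / q ^ 2) / 3)) := by
  simp only [graphMean, sampleMean_succ, sampleMean_zero]
  change 𝔼 a, 𝔼 b, 𝔼 c, 𝔼 d,
    ordSign a b * (ordSign b c * (ordSign c d * (ordSign c d * 1))) = _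
  rw [Finset.expect_comm]
  simp only [mul_one, ← sq, ← Finset.mul_expect, ← Finset.expect_mul, expect_ordSign_sq,
    expect_ordSign, expect_ordSign_right, ← mul_assoc, neg_mul, Finset.expect_neg_distrib,
    expect_centredRank_sq]
  ring

theorem graphMean_ordSign_star_double_edge :
    graphMean (ordSign (α := Fin q)) ⟨4, [(0, 1), (1, 2), (1, 3), (1, 3)]⟩ =
      -((1 - 1 / q) * ((1 - 1 / q ^ 2) / 3)) := by
  simp only [graphMean, sampleMean_succ, sampleMean_zero]
  change 𝔼 a, 𝔼 b, 𝔼 c, 𝔼 d,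
    ordSign a b * (ordSign b c * (ordSign b d * (ordSign b d * 1))) = _
  rw [Finset.expect_comm]
  simp only [mul_one, ← sq, ← Finset.mul_expect, ← Finset.expect_mul, expect_ordSign_sq,
    expect_ordSign, expect_ordSign_right, ← mul_assoc, neg_mul, Finset.expect_neg_distrib,
    expect_centredRank_sq]
  ring

theorem graphMean_ordSign_path_double_edge_disjoint :
    graphMean (ordSign (α := Fin q)) ⟨5, [(0, 1), (1, 2), (3, 4), (3, 4)]⟩ =
      -((1 - 1 / q) * ((1 - 1 / q ^ 2) / 3)) := by
  simp only [graphMean, sampleMean_succ, sampleMean_zero]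
  change 𝔼 a, 𝔼 b, 𝔼 c, 𝔼 d, 𝔼 e,
    ordSign a b * (ordSign b c * (ordSign d e * (ordSign d e * 1))) = _
  rw [Finset.expect_comm]
  simp only [mul_one, ← sq, ← Finset.mul_expect, ← Finset.expect_mul, expect_ordSign_sq,
    Fintype.expect_const, expect_ordSign, expect_ordSign_right, ← mul_assoc, neg_mul,
    Finset.expect_neg_distrib, expect_centredRank_sq]
  ring

theorem graphMean_ordSign_paths_disjoint :
    graphMean (ordSign (α := Fin q)) ⟨6, [(0, 1), (1, 2), (3, 4), (4, 5)]⟩ =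
      ((1 - 1 / q ^ 2) / 3) ^ 2 := by
  have hpath : 𝔼 a : Fin q, 𝔼 b, ordSign a b * centredRank b = -((1 - 1 / (q : ℝ) ^ 2) / 3) := by
    rw [Finset.expect_comm]
    simp only [← Finset.expect_mul, expect_ordSign_right, neg_mul, ← sq,
      Finset.expect_neg_distrib, expect_centredRank_sq]
  simp only [graphMean, sampleMean_succ, sampleMean_zero]
  change 𝔼 a, 𝔼 b, 𝔼 c, 𝔼 d, 𝔼 e, 𝔼 f,
    ordSign a b * (ordSign b c * (ordSign d e * (ordSign e f * 1))) = _
  simp only [mul_one, ← Finset.mul_expect, expect_ordSign, hpath]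
  simp only [← mul_assoc, ← Finset.expect_mul, expect_ordSign, hpath, neg_mul_neg, sq]

theorem graphMean_ordSign_paw :
    graphMean (ordSign (α := Fin q)) ⟨4, [(0, 1), (1, 2), (0, 2), (2, 3)]⟩ = 0 := by
  simp only [graphMean, sampleMean_succ, sampleMean_zero]
  change 𝔼 a, 𝔼 b, 𝔼 c, 𝔼 d,
    ordSign a b * (ordSign b c * (ordSign a c * (ordSign c d * 1))) = _
  refine expect_expect_eq_zero_of_antisymm fun a b => ?_
  simp only [← Finset.mul_expect, ordSign_swap a b, neg_mul,
    Finset.expect_neg_distrib, mul_left_comm (ordSign b _) (ordSign a _)]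

theorem graphMean_ordSign_star :
    graphMean (ordSign (α := Fin q)) ⟨5, [(0, 1), (1, 2), (1, 3), (1, 4)]⟩ =
      -((1 - 1 / q ^ 2) * (3 - 7 / q ^ 2) / 15) := by
  simp only [graphMean, sampleMean_succ, sampleMean_zero]
  change 𝔼 a, 𝔼 b, 𝔼 c, 𝔼 d, 𝔼 e,
    ordSign a b * (ordSign b c * (ordSign b d * (ordSign b e * 1))) = _
  rw [Finset.expect_comm]
  simp only [mul_one, ← Finset.mul_expect, ← Finset.expect_mul, expect_ordSign,
    expect_ordSign_right, neg_mul, ← pow_succ', ← sq, Nat.reduceAdd, Finset.expect_neg_distrib,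
    expect_centredRank_pow_four]

theorem graphMean_ordSign_fork :
    graphMean (ordSign (α := Fin q)) ⟨5, [(0, 1), (1, 2), (1, 3), (3, 4)]⟩ =
      (1 - 1 / q ^ 2) * (1 + 1 / q ^ 2) / 15 := by
  simp only [graphMean, sampleMean_succ, sampleMean_zero]
  change 𝔼 a, 𝔼 b, 𝔼 c, 𝔼 d, 𝔼 e,
    ordSign a b * (ordSign b c * (ordSign b d * (ordSign d e * 1))) = _
  have hpow : ∀ b : Fin q, centredRank b *
      (centredRank b * ((centredRank b ^ 2 - (1 - 1 / (q : ℝ) ^ 2)) / 2)) =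
        centredRank b ^ 4 / 2 - centredRank b ^ 2 * ((1 - 1 / (q : ℝ) ^ 2) / 2) :=
    fun b => by ring
  rw [Finset.expect_comm]
  simp only [mul_one, ← Finset.mul_expect, ← Finset.expect_mul, expect_ordSign,
    expect_ordSign_right, expect_ordSign_mul_centredRank, neg_mul, hpow,
    Finset.expect_neg_distrib, Finset.expect_sub_distrib, ← Finset.expect_div,
    expect_centredRank_sq, expect_centredRank_pow_four]
  ring

theorem graphMean_ordSign_path_five :
    graphMean (ordSign (α := Fin q)) ⟨5, [(0, 1), (1, 2), (2, 3), (3, 4)]⟩ =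
      (1 - 1 / q ^ 2) * (2 - 3 / q ^ 2) / 15 := by
  simp only [graphMean, sampleMean_succ, sampleMean_zero]
  change 𝔼 a, 𝔼 b, 𝔼 c, 𝔼 d, 𝔼 e,
    ordSign a b * (ordSign b c * (ordSign c d * (ordSign d e * 1))) = _
  have hsquare : ∀ c : Fin q, 𝔼 b, -(centredRank b * (ordSign b c *
      ((centredRank c ^ 2 - (1 - 1 / (q : ℝ) ^ 2)) / 2))) =
        centredRank c ^ 4 / 4 - centredRank c ^ 2 * ((1 - 1 / (q : ℝ) ^ 2) / 2) +
          (1 - 1 / (q : ℝ) ^ 2) ^ 2 / 4 := fun c => by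
    have hswap := Finset.expect_congr rfl fun b (_ : b ∈ Finset.univ) =>
      (neg_mul_comm (centredRank b) (ordSign b c)).trans <| by rw [← ordSign_swap c b, mul_comm]
    simp only [← mul_assoc, ← neg_mul, ← Finset.expect_mul, hswap, expect_ordSign_mul_centredRank]
    ring
  rw [Finset.expect_comm]
  simp only [mul_one, ← Finset.mul_expect, ← Finset.expect_mul, expect_ordSign,
    expect_ordSign_right, expect_ordSign_mul_centredRank, neg_mul]
  simp only [Finset.mul_expect, ← Finset.expect_neg_distrib]
  rw [Finset.expect_comm]
  simp only [hsquare, Finset.expect_sub_distrib, Finset.expect_add_distrib, ← Finset.expect_div,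
    ← Finset.expect_mul, Fintype.expect_const, expect_centredRank_sq, expect_centredRank_pow_four]
  ring

theorem graphMean_ordSign_four_cycle :
    graphMean (ordSign (α := Fin q)) ⟨4, [(0, 1), (1, 2), (2, 3), (0, 3)]⟩ =
      -((1 - 4 / q ^ 2 + 3 / q ^ 3) / 3) := by
  simp only [graphMean, sampleMean_succ, sampleMean_zero]
  change 𝔼 a, 𝔼 b, 𝔼 c, 𝔼 d,
    ordSign a b * (ordSign b c * (ordSign c d * (ordSign a d * 1))) = _
  have hsplit : ∀ a b c d : Fin q,
      ordSign a b * (ordSign b c * (ordSign c d * (ordSign a d * 1))) =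
        -(ordSign a b * ordSign c b * (ordSign a d * ordSign c d)) := fun a b c d => by
    rw [ordSign_swap b c]
    ring
  have hsq : ∀ a c : Fin q,
      (1 - (if c = a then 1 else 0) / q - ordSign a c * (centredRank a - centredRank c)) *
        (1 - (if c = a then 1 else 0) / q - ordSign a c * (centredRank a - centredRank c)) =
      1 - (if c = a then 1 else 0) * (2 / q - 1 / q ^ 2) + centredRank a ^ 2 +
        centredRank c ^ 2 - 2 * (centredRank a * centredRank c) -
        2 * (centredRank a * ordSign a c) + 2 * (ordSign a c * centredRank c) := fun a c => by
    split_ifs with h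
    · subst h
      rw [ordSign_self]
      ring
    · linear_combination (centredRank a - centredRank c) ^ 2 * ordSign_sq a c -
        (if_neg h : (if c = a then (1 : ℝ) else 0) = 0) * (centredRank a - centredRank c) ^ 2
  simp only [hsplit, fun a => Finset.expect_comm Finset.univ Finset.univ fun b c =>
    𝔼 d, -(ordSign (a : Fin q) b * ordSign c b * (ordSign a d * ordSign c d))]
  simp only [Finset.expect_neg_distrib, ← Finset.mul_expect, ← Finset.expect_mul,
    expect_ordSign_mul_ordSign]
  simp only [hsq, Finset.expect_sub_distrib, Finset.expect_add_distrib, expect_ite_eq_mul]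
  simp only [← Finset.mul_expect, expect_ordSign, expect_centredRank,
    expect_ordSign_mul_centredRank, mul_zero, ← sq, ← Finset.expect_div, Finset.expect_sub_distrib,
    Fintype.expect_const, expect_centredRank_sq]
  ring

end GraphMeans

section TensorKernel

variable {α β : Type*}

/-- The kernel on pairs that multiplies a kernel of the first components and a kernel of the second
components. -/
def tensorKernel (g : α → α → ℝ) (h : β → β → ℝ) (a b : α × β) : ℝ :=
  g a.1 b.1 * h a.2 b.2

variable [Fintype α] [Fintype β] {g : α → α → ℝ} {h : β → β → ℝ}

theorem expect_fst_mul_snd (f : α → ℝ) (g : β → ℝ) :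
    𝔼 p : α × β, f p.1 * g p.2 = (𝔼 a, f a) * 𝔼 b, g b := by
  rw [Fintype.expect_mul_expect, ← Finset.expect_product', Finset.univ_product_univ]

theorem expect_tensorKernel (a : α × β) :
    𝔼 b, tensorKernel g h a b = (𝔼 b, g a.1 b) * 𝔼 b, h a.2 b :=
  expect_fst_mul_snd ..

theorem graphMean_tensorKernel [Inhabited α] [Inhabited β] (G : Multigraph) :
    graphMean (tensorKernel g h) G = graphMean g G * graphMean h G := by
  rw [graphMean, graphMean, graphMean, ← sampleMean_prod]
  congr 1 with z
  exact List.prod_map_mul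

end TensorKernel

section Concordance

variable {α β ι : Type*} [LinearOrder α] [LinearOrder β] [Fintype ι]

/-- Twice the number of pairs of indices that `x` and `y` rank in the same order, minus twice the
number of pairs that they rank in opposite orders. -/
def concordance (x : ι → α) (y : ι → β) : ℝ :=
  ∑ k, ∑ l, ordSign (x k) (x l) * ordSign (y k) (y l)

theorem concordance_eq_pairSum (x : ι → α) (y : ι → β) :
    concordance x y = pairSum (tensorKernel ordSign ordSign) fun k => (x k, y k) := by
  rw [concordance, ← Fintype.sum_prod_type', pairSum]
  refine (Finset.sum_subset (Finset.subset_univ _) fun e _ he => ?_).symm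
  have he : e.1 = e.2 := by simpa only [Finset.mem_offDiag, Finset.mem_univ, true_and, not_not,
    ne_eq] using he
  rw [he, ordSign_self, zero_mul]

theorem tensorKernel_ordSign_comm (a b : α × β) :
    tensorKernel ordSign ordSign a b = tensorKernel ordSign ordSign b a := by
  rw [tensorKernel, tensorKernel, ordSign_swap a.1, ordSign_swap a.2, neg_mul_neg]

theorem expect_comp_concordance {𝕜 : Type*} [Field 𝕜] [CharZero 𝕜] [Fintype α] [Fintype β]
    [DecidableEq ι] (φ : ℝ → 𝕜) :
    𝔼 p : (ι → α) × (ι → β), φ (concordance p.1 p.2) =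
      𝔼 z : ι → α × β, φ (pairSum (tensorKernel ordSign ordSign) z) :=
  (Fintype.expect_equiv (Equiv.arrowProdEquivProdArrow ..) _ _ fun z =>
    congrArg φ (concordance_eq_pairSum (Prod.fst ∘ z) (Prod.snd ∘ z)).symm).symm

end Concordance

section ConcordanceMoments

variable {n : ℕ}

theorem expect_tensorKernel_ordSign (a : Fin n × Fin n) :
    𝔼 b, tensorKernel ordSign ordSign a b = centredRank a.1 * centredRank a.2 := by
  simp only [expect_tensorKernel, expect_ordSign]

theorem expect_expect_tensorKernel_ordSign :
    𝔼 a : Fin n × Fin n, 𝔼 b, tensorKernel ordSign ordSign a b = 0 := by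
  simp only [expect_tensorKernel_ordSign, expect_fst_mul_snd, expect_centredRank, mul_zero]

variable [NeZero n]

theorem expect_expect_tensorKernel_ordSign_sq :
    𝔼 a : Fin n × Fin n, (𝔼 b, tensorKernel ordSign ordSign a b) ^ 2 =
      ((1 - 1 / (n : ℝ) ^ 2) / 3) ^ 2 := by
  simp only [expect_tensorKernel_ordSign, mul_pow]
  rw [expect_fst_mul_snd (fun a => centredRank a ^ 2) fun a => centredRank a ^ 2,
    expect_centredRank_sq, ← sq]

theorem expect_concordance :
    𝔼 p : (Fin n → Fin n) × (Fin n → Fin n), concordance p.1 p.2 = 0 := by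
  have hmoment := expect_pairSum_pow_succ tensorKernel_ordSign_comm
    (expect_expect_tensorKernel_ordSign (n := n)) n 0
  simp only [zero_add, pow_one, Multigraph.nonisolatedTypes_zero] at hmoment
  exact (expect_comp_concordance id).trans hmoment

/-- The second moment of half the concordance of two independent uniform vectors of length `n` with
entries in `Fin n`. -/
def concordanceVar (n : ℕ) : ℝ :=
  ((n : ℝ) - 1) ^ 3 * (2 * n ^ 3 + 9 * n ^ 2 - 6 * n - 4) / (18 * n ^ 3)

/-- The fourth moment of half the concordance of two independent uniform vectors of length `n` with
entries in `Fin n`. -/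
def concordanceFourth (n : ℕ) : ℝ :=
  ((n : ℝ) - 1) ^ 3 *
    (300 * n ^ 10 + 1584 * n ^ 9 - 4113 * n ^ 8 - 17601 * n ^ 7 + 34245 * n ^ 6 + 100773 * n ^ 5
      - 220962 * n ^ 4 - 68040 * n ^ 3 + 359064 * n ^ 2 - 108048 * n - 110016) / (8100 * n ^ 7)

theorem expect_concordance_sq :
    𝔼 p : (Fin n → Fin n) × (Fin n → Fin n), concordance p.1 p.2 ^ 2 = 4 * concordanceVar n := by
  have hn := NeZero.ne (n : ℝ)
  rw [expect_comp_concordance (· ^ 2),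
    expect_pairSum_pow_succ tensorKernel_ordSign_comm expect_expect_tensorKernel_ordSign,
    Multigraph.nonisolatedTypes_one]
  simp only [Multigraph.weightedSum, List.map_cons, List.map_nil, List.sum_cons, List.sum_nil,
    graphMean_tensorKernel, graphMean_ordSign_double_edge, graphMean_ordSign_path_three,
    cast_descFactorial_succ, Nat.descFactorial_zero, concordanceVar]
  push_cast
  field_simp
  ring

theorem expect_concordance_pow_four :
    𝔼 p : (Fin n → Fin n) × (Fin n → Fin n), concordance p.1 p.2 ^ 4 =
      16 * concordanceFourth n := by
  have hn := NeZero.ne (n : ℝ)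
  rw [expect_comp_concordance (· ^ 4),
    expect_pairSum_pow_succ tensorKernel_ordSign_comm expect_expect_tensorKernel_ordSign,
    Multigraph.nonisolatedTypes_three]
  simp only [Multigraph.weightedSum, List.map_cons, List.map_nil, List.sum_cons, List.sum_nil,
    graphMean_tensorKernel, graphMean_ordSign_quadruple_edge,
    graphMean_ordSign_triple_edge_pendant, graphMean_ordSign_double_edges_path,
    graphMean_ordSign_double_edges_disjoint, graphMean_ordSign_doubled_triangle,
    graphMean_ordSign_path_double_middle, graphMean_ordSign_path_double_end,
    graphMean_ordSign_star_double_edge, graphMean_ordSign_path_double_edge_disjoint,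
    graphMean_ordSign_paths_disjoint, graphMean_ordSign_paw, graphMean_ordSign_star,
    graphMean_ordSign_fork, graphMean_ordSign_path_five, graphMean_ordSign_four_cycle,
    cast_descFactorial_succ, Nat.descFactorial_zero, concordanceFourth]
  push_cast
  field_simp
  ring

end ConcordanceMoments

section HajekProjection

variable {α : Type*} [Fintype α] {h : α → α → ℝ} {M : ℝ}

/-- The conditional mean of a kernel given its first argument. -/
def kernelProj (h : α → α → ℝ) (a : α) : ℝ := 𝔼 b, h a b

/-- What remains of a symmetric kernel of mean zero after its projections onto either argument have
been subtracted. -/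
def degenerateKernel (h : α → α → ℝ) (a b : α) : ℝ := h a b - kernelProj h a - kernelProj h b

theorem degenerateKernel_comm (hsymm : ∀ a b, h a b = h b a) (a b : α) :
    degenerateKernel h a b = degenerateKernel h b a := by
  rw [degenerateKernel, degenerateKernel, hsymm, sub_right_comm]

theorem pairSum_degenerateKernel {ι : Type*} [Fintype ι] (z : ι → α) :
    pairSum (degenerateKernel h) z =
      pairSum h z - 2 * (Fintype.card ι - 1) * ∑ k, kernelProj h (z k) := by
  classical
  have hsplit := Finset.sum_union (s₁ := Finset.univ.diag) (s₂ := Finset.univ.offDiag)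
    (Finset.disjoint_diag_offDiag (Finset.univ : Finset ι))
    (f := fun e => kernelProj h (z e.1) + kernelProj h (z e.2))
  rw [Finset.diag_union_offDiag, Finset.sum_diag, Finset.univ_product_univ,
    Fintype.sum_prod_type] at hsplit
  simp only [Finset.sum_add_distrib, Finset.sum_const, Finset.card_univ, nsmul_eq_mul,
    ← Finset.mul_sum] at hsplit
  simp only [pairSum, degenerateKernel, Finset.sum_sub_distrib]
  linarith

theorem abs_kernelProj_le (hbound : ∀ a b, |h a b| ≤ M) (a : α) : |kernelProj h a| ≤ M :=
  (Finset.abs_expect_le ..).trans (Finset.expect_le ⟨a, Finset.mem_univ a⟩ fun b _ => hbound a b)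

theorem abs_degenerateKernel_le (hbound : ∀ a b, |h a b| ≤ M) (a b : α) :
    |degenerateKernel h a b| ≤ 3 * M := by
  grind [degenerateKernel, hbound a b, abs_kernelProj_le hbound a, abs_kernelProj_le hbound b]

theorem sq_expect_abs_le (f : α → ℝ) : (𝔼 a, |f a|) ^ 2 ≤ 𝔼 a, f a ^ 2 := by
  rcases isEmpty_or_nonempty α with _ | _
  · simp only [Finset.univ_eq_empty, Finset.expect_empty, sq, zero_mul, le_refl]
  · simpa only [mul_one, one_pow, sq_abs, Fintype.expect_const] using
      Finset.expect_mul_sq_le_sq_mul_sq Finset.univ (fun a => |f a|) fun _ => 1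

variable [Inhabited α]

theorem kernelProj_degenerateKernel (hmean : 𝔼 a, 𝔼 b, h a b = 0) :
    kernelProj (degenerateKernel h) = 0 := by
  funext a
  have hproj : 𝔼 b, kernelProj h b = 0 := hmean
  simp only [kernelProj.eq_1 (degenerateKernel h), degenerateKernel, Finset.expect_sub_distrib,
    Fintype.expect_const, hproj, sub_zero]
  exact sub_self _

theorem expect_pairSum_sq_of_kernelProj_eq_zero (hsymm : ∀ a b, h a b = h b a)
    (hproj : kernelProj h = 0) (n : ℕ) :
    𝔼 z : Fin n → α, pairSum h z ^ 2 = 2 * n * (n - 1) * 𝔼 a, 𝔼 b, h a b ^ 2 := by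
  have hzero : ∀ a, 𝔼 b, h a b = 0 := congrFun hproj
  have hpath : graphMean h ⟨3, [(0, 1), (1, 2)]⟩ = 0 := by
    simp only [graphMean, sampleMean_succ, sampleMean_zero]
    change 𝔼 a, 𝔼 b, 𝔼 c, h a b * (h b c * 1) = _
    simp only [mul_one, ← Finset.mul_expect, hzero, mul_zero, Finset.expect_const_zero]
  have hdouble : graphMean h ⟨2, [(0, 1), (0, 1)]⟩ = 𝔼 a, 𝔼 b, h a b ^ 2 := by
    simp only [graphMean, sampleMean_succ, sampleMean_zero]
    change 𝔼 a, 𝔼 b, h a b * (h a b * 1) = _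
    simp only [mul_one, ← sq]
  have hmean : 𝔼 a, 𝔼 b, h a b = 0 := by simp only [hzero, Finset.expect_const_zero]
  rw [expect_pairSum_pow_succ hsymm hmean, Multigraph.nonisolatedTypes_one]
  simp only [Multigraph.weightedSum, List.map_cons, List.map_nil, List.sum_cons, List.sum_nil,
    hpath, hdouble, cast_descFactorial_succ, Nat.descFactorial_zero]
  push_cast
  ring

theorem expect_abs_pairSum_sub_proj_le (hsymm : ∀ a b, h a b = h b a)
    (hmean : 𝔼 a, 𝔼 b, h a b = 0) (hbound : ∀ a b, |h a b| ≤ M) (n : ℕ) :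
    𝔼 z : Fin n → α, |pairSum h z - 2 * (n - 1) * ∑ k, kernelProj h (z k)| ≤ 5 * M * n := by
  have hM : 0 ≤ M := (abs_nonneg _).trans (hbound default default)
  have hsq : 𝔼 a, 𝔼 b, degenerateKernel h a b ^ 2 ≤ (3 * M) ^ 2 :=
    Finset.expect_le Finset.univ_nonempty fun a _ => Finset.expect_le Finset.univ_nonempty
      fun b _ => sq_le_sq.mpr ((abs_degenerateKernel_le hbound a b).trans (le_abs_self _))
  have hmoment := (sq_expect_abs_le _).trans_eq (expect_pairSum_sq_of_kernelProj_eq_zero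
    (degenerateKernel_comm hsymm) (kernelProj_degenerateKernel hmean) n)
  simp only [pairSum_degenerateKernel, Fintype.card_fin] at hmoment
  refine le_of_sq_le_sq (hmoment.trans ?_) (by positivity)
  calc 2 * (n : ℝ) * (n - 1) * 𝔼 a, 𝔼 b, degenerateKernel h a b ^ 2
      ≤ 2 * n * n * (3 * M) ^ 2 := by
        refine mul_le_mul ?_ hsq (Finset.expect_nonneg fun a _ => Finset.expect_nonneg
          fun b _ => sq_nonneg _) (by positivity)
        nlinarith [Nat.cast_nonneg (α := ℝ) n]
    _ ≤ (5 * M * n) ^ 2 := by nlinarith [sq_nonneg (M * n)]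

end HajekProjection

section TriangularArray

theorem norm_exp_I_mul_sub_le (x y : ℝ) :
    ‖Complex.exp (Complex.I * x) - Complex.exp (Complex.I * y)‖ ≤ |x - y| := by
  have hfactor : Complex.exp (Complex.I * x) - Complex.exp (Complex.I * y) =
      Complex.exp (Complex.I * y) * (Complex.exp (Complex.I * (x - y : ℝ)) - 1) := by
    rw [mul_sub, ← Complex.exp_add, mul_one, Complex.ofReal_sub]
    congr 2
    ring
  rw [hfactor, norm_mul, mul_comm Complex.I (y : ℂ), Complex.norm_exp_ofReal_mul_I, one_mul]
  exact Real.norm_exp_I_mul_ofReal_sub_one_le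

theorem norm_expect_exp_I_mul_sub_le {α : Type*} [Fintype α] (f g : α → ℝ) :
    ‖𝔼 a, Complex.exp (Complex.I * f a) - 𝔼 a, Complex.exp (Complex.I * g a)‖ ≤
      𝔼 a, |f a - g a| := by
  rw [← Finset.expect_sub_distrib]
  exact (RCLike.norm_expect_le (K := ℂ)).trans
    (Finset.expect_le_expect fun a _ => norm_exp_I_mul_sub_le _ _)

theorem norm_exp_I_mul_sub_quadratic_le {x : ℝ} (hx : |x| ≤ 1) :
    ‖Complex.exp (Complex.I * x) - (1 + Complex.I * x - (x ^ 2 / 2 : ℝ))‖ ≤ |x| ^ 3 := by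
  have hnorm : ‖Complex.I * (x : ℂ)‖ = |x| := by
    rw [norm_mul, Complex.norm_I, one_mul, Complex.norm_real, Real.norm_eq_abs]
  have htaylor := Complex.exp_bound (hnorm.trans_le hx) three_pos
  have hsum : ∑ m ∈ Finset.range 3, (Complex.I * x) ^ m / m.factorial =
      1 + Complex.I * x - (x ^ 2 / 2 : ℝ) := by
    simp only [Finset.sum_range_succ, Finset.sum_range_zero, Nat.factorial]
    push_cast
    linear_combination (x ^ 2 / 2 : ℂ) * Complex.I_sq
  rw [hsum, hnorm] at htaylor
  refine htaylor.trans (mul_le_of_le_one_right (by positivity) ?_)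
  norm_num [Nat.factorial]

theorem norm_expect_exp_I_mul_sub_le_of_mean_zero {α : Type*} [Fintype α] [Nonempty α]
    {f : α → ℝ} {b : ℝ} (hmean : 𝔼 a, f a = 0) (hf : ∀ a, |f a| ≤ b) (hb : b ≤ 1) :
    ‖𝔼 a, Complex.exp (Complex.I * f a) - (1 - ((𝔼 a, f a ^ 2) / 2 : ℝ))‖ ≤
      b * 𝔼 a, f a ^ 2 := by
  have hquadratic : 𝔼 a, (1 + Complex.I * f a - (f a ^ 2 / 2 : ℝ)) =
      (1 - ((𝔼 a, f a ^ 2) / 2 : ℝ) : ℂ) := by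
    rw [Finset.expect_sub_distrib, Finset.expect_add_distrib, ← Finset.mul_expect,
      Fintype.expect_const, ← Complex.ofReal_expect, ← Complex.ofReal_expect, hmean,
      Complex.ofReal_zero, mul_zero, add_zero, Finset.expect_div]
  rw [← hquadratic, ← Finset.expect_sub_distrib, Finset.mul_expect]
  refine (RCLike.norm_expect_le (K := ℂ)).trans (Finset.expect_le_expect fun a _ =>
    (norm_exp_I_mul_sub_quadratic_le ((hf a).trans hb)).trans ?_)
  rw [pow_succ', sq_abs]
  gcongr
  exact hf a

theorem expect_exp_I_mul_sum {α : Type*} [Fintype α] (f : α → ℝ) (n : ℕ) :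
    𝔼 z : Fin n → α, Complex.exp (Complex.I * (∑ k, f (z k) : ℝ)) =
      (𝔼 a, Complex.exp (Complex.I * f a)) ^ n := by
  rw [Finset.expect_pow, Fintype.piFinset_univ]
  simp only [Complex.ofReal_sum, Finset.mul_sum, Complex.exp_sum]

theorem norm_expect_exp_I_mul_pairSum_sub_le {α : Type*} [Fintype α] [Inhabited α]
    {h : α → α → ℝ} {M : ℝ} (hsymm : ∀ a b, h a b = h b a) (hmean : 𝔼 a, 𝔼 b, h a b = 0)
    (hbound : ∀ a b, |h a b| ≤ M) (n : ℕ) (s : ℝ) :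
    ‖𝔼 z : Fin n → α, Complex.exp (Complex.I * (s * pairSum h z : ℝ)) -
      𝔼 z : Fin n → α,
        Complex.exp (Complex.I * (∑ k, s * (2 * (n - 1)) * kernelProj h (z k) : ℝ))‖ ≤
      |s * n| * (5 * M) := by
  calc _ ≤ 𝔼 z : Fin n → α, |s * pairSum h z - ∑ k, s * (2 * (n - 1)) * kernelProj h (z k)| :=
        norm_expect_exp_I_mul_sub_le _ _
    _ = |s| * 𝔼 z : Fin n → α, |pairSum h z - 2 * (n - 1) * ∑ k, kernelProj h (z k)| := by
        simp only [Finset.mul_expect, ← abs_mul, ← Finset.mul_sum, mul_sub s, mul_assoc]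
    _ ≤ |s| * (5 * M * n) := mul_le_mul_of_nonneg_left
        (expect_abs_pairSum_sub_proj_le hsymm hmean hbound n) (abs_nonneg _)
    _ = |s * n| * (5 * M) := by
        rw [abs_mul, Nat.abs_cast]
        ring

variable {α : ℕ → Type*} [∀ n, Fintype (α n)]

theorem tendsto_expect_exp_I_mul_sum (hα : ∀ᶠ n in atTop, Nonempty (α n))
    {f : ∀ n, α n → ℝ} {b : ℕ → ℝ} {v : ℝ} (hmean : ∀ n, 𝔼 a, f n a = 0)
    (hf : ∀ n a, |f n a| ≤ b n) (hb : Tendsto b atTop (𝓝 0))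
    (hv : Tendsto (fun n => n * 𝔼 a, f n a ^ 2) atTop (𝓝 v)) :
    Tendsto (fun n => 𝔼 z : Fin n → α n, Complex.exp (Complex.I * (∑ k, f n (z k) : ℝ))) atTop
      (𝓝 (Complex.exp (-v / 2))) := by
  have herr : Tendsto (fun n : ℕ => (n : ℂ) *
      (𝔼 a, Complex.exp (Complex.I * f n a) - (1 - ((𝔼 a, f n a ^ 2) / 2 : ℝ)))) atTop (𝓝 0) := by
    refine squeeze_zero_norm' ?_ (by simpa only [zero_mul] using hb.mul hv)
    filter_upwards [hα, hb.eventually_le_const zero_lt_one] with n _ hbn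
    rw [norm_mul, Complex.norm_natCast, mul_left_comm]
    gcongr
    exact norm_expect_exp_I_mul_sub_le_of_mean_zero (hmean n) (hf n) hbn
  have hmain : Tendsto (fun n : ℕ => ((-(n * 𝔼 a, f n a ^ 2) / 2 : ℝ) : ℂ)) atTop
      (𝓝 (-v / 2)) := by
    exact_mod_cast (Complex.continuous_ofReal.tendsto _).comp (hv.neg.div_const 2)
  have hsum : Tendsto (fun n : ℕ => (n : ℂ) * (𝔼 a, Complex.exp (Complex.I * f n a) - 1)) atTop
      (𝓝 (-v / 2)) := by
    refine (by simpa only [zero_add] using herr.add hmain : Tendsto _ _ _).congr fun n => ?_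
    push_cast
    ring
  simpa only [expect_exp_I_mul_sum, add_sub_cancel] using
    Complex.tendsto_one_add_pow_exp_of_tendsto hsum

theorem tendsto_zero_of_tendsto_natCast_mul_sq {c : ℕ → ℝ} {w : ℝ}
    (hc : Tendsto (fun n : ℕ => n * c n ^ 2) atTop (𝓝 w)) : Tendsto c atTop (𝓝 0) := by
  have hsq : Tendsto (fun n => c n ^ 2) atTop (𝓝 0) := by
    have h := hc.div_atTop tendsto_natCast_atTop_atTop
    refine h.congr' ?_
    filter_upwards [eventually_ne_atTop 0] with n hn
    exact mul_div_cancel_left₀ _ (Nat.cast_ne_zero.mpr hn)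
  refine (tendsto_zero_iff_abs_tendsto_zero _).mpr ?_
  simpa only [Real.sqrt_sq_eq_abs, Real.sqrt_zero, Function.comp_def] using hsq.sqrt

theorem tendsto_natCast_mul_sq_mul_pred {s : ℕ → ℝ} {τ : ℝ}
    (hs : Tendsto (fun n : ℕ => n ^ 3 * s n ^ 2) atTop (𝓝 τ)) :
    Tendsto (fun n : ℕ => n * (s n * (2 * (n - 1))) ^ 2) atTop (𝓝 (4 * τ)) := by
  have hpred : Tendsto (fun n : ℕ => 1 - (1 : ℝ) / n) atTop (𝓝 1) := by
    simpa only [sub_zero] using tendsto_one_div_atTop_nhds_zero_nat.const_sub (1 : ℝ)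
  have h := (hs.const_mul 4).mul (hpred.pow 2)
  rw [one_pow, mul_one] at h
  refine h.congr' ?_
  filter_upwards [eventually_ne_atTop 0] with n hn
  field_simp
  ring

/-- Hájek's method: the pair sum is asymptotic to a sum of independent terms, its projection. -/
theorem tendsto_expect_exp_I_mul_pairSum (hα : ∀ᶠ n in atTop, Nonempty (α n))
    {h : ∀ n, α n → α n → ℝ} {M v τ : ℝ} {s : ℕ → ℝ} (hsymm : ∀ n a b, h n a b = h n b a)
    (hmean : ∀ n, 𝔼 a, 𝔼 b, h n a b = 0) (hbound : ∀ n a b, |h n a b| ≤ M)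
    (hv : Tendsto (fun n => 𝔼 a, kernelProj (h n) a ^ 2) atTop (𝓝 v))
    (hs : Tendsto (fun n : ℕ => n ^ 3 * s n ^ 2) atTop (𝓝 τ)) :
    Tendsto (fun n => 𝔼 z : Fin n → α n, Complex.exp (Complex.I * (s n * pairSum (h n) z : ℝ)))
      atTop (𝓝 (Complex.exp (-(2 * v * τ)))) := by
  let c : ℕ → ℝ := fun n => s n * (2 * (n - 1))
  have hc : Tendsto (fun n : ℕ => n * c n ^ 2) atTop (𝓝 (4 * τ)) :=
    tendsto_natCast_mul_sq_mul_pred hs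
  have hsn : Tendsto (fun n : ℕ => s n * n) atTop (𝓝 0) :=
    tendsto_zero_of_tendsto_natCast_mul_sq (hs.congr fun n => by ring)
  have hproj := tendsto_expect_exp_I_mul_sum hα (f := fun n a => c n * kernelProj (h n) a)
    (b := fun n => |c n| * M) (v := 4 * τ * v)
    (fun n => by
      rw [← Finset.mul_expect]
      exact mul_eq_zero_of_right _ (hmean n))
    (fun n a => (abs_mul _ _).trans_le
      (mul_le_mul_of_nonneg_left (abs_kernelProj_le (hbound n) a) (abs_nonneg _)))
    (by simpa only [abs_zero, zero_mul] using
      (tendsto_zero_of_tendsto_natCast_mul_sq hc).abs.mul_const M)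
    ((hc.mul hv).congr fun n => by simp only [mul_pow, ← Finset.mul_expect, mul_assoc])
  have herr : Tendsto (fun n => 𝔼 z : Fin n → α n,
      Complex.exp (Complex.I * (s n * pairSum (h n) z : ℝ)) - 𝔼 z : Fin n → α n,
        Complex.exp (Complex.I * (∑ k, c n * kernelProj (h n) (z k) : ℝ))) atTop (𝓝 0) := by
    refine squeeze_zero_norm' (a := fun n : ℕ => |s n * n| * (5 * M)) ?_
      (by simpa only [abs_zero, zero_mul] using hsn.abs.mul_const (5 * M))
    filter_upwards [hα] with n hαn
    have := Classical.inhabited_of_nonempty hαn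
    exact norm_expect_exp_I_mul_pairSum_sub_le (hsymm n) (hmean n) (hbound n) n (s n)
  convert herr.add hproj using 2 with n
  · exact (sub_add_cancel _ _).symm
  · rw [zero_add]
    congr 2
    push_cast
    ring

end TriangularArray

theorem tendsto_expect_exp_concordance {σ : ℕ → ℝ}
    (hσ : Tendsto (fun n : ℕ => σ n ^ 2 / (n : ℝ) ^ 3) atTop (𝓝 (1 / 9))) (t : ℝ) :
    Tendsto (fun n => 𝔼 p : (Fin n → Fin n) × (Fin n → Fin n),
        Complex.exp (Complex.I * (-t / (2 * σ n) * concordance p.1 p.2 : ℝ))) atTop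
      (𝓝 (Complex.exp (-(t : ℂ) ^ 2 / 2))) := by
  have hv : Tendsto (fun n : ℕ => 𝔼 a : Fin n × Fin n,
      kernelProj (tensorKernel ordSign ordSign) a ^ 2) atTop (𝓝 (1 / 9)) := by
    have h : Tendsto (fun n : ℕ => ((1 - (1 / (n : ℝ)) ^ 2) / 3) ^ 2) atTop (𝓝 (1 / 9)) := by
      convert! ((tendsto_one_div_atTop_nhds_zero_nat.pow 2).const_sub 1).div_const (3 : ℝ) |>.pow 2
        using 2
      norm_num
    refine h.congr' ?_
    filter_upwards [eventually_ne_atTop 0] with n hn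
    have : NeZero n := ⟨hn⟩
    rw [one_div_pow]
    exact expect_expect_tensorKernel_ordSign_sq.symm
  have hs : Tendsto (fun n : ℕ => (n : ℝ) ^ 3 * (-t / (2 * σ n)) ^ 2) atTop
      (𝓝 (t ^ 2 / 4 * 9)) := by
    have h := (hσ.inv₀ (by norm_num)).const_mul (t ^ 2 / 4)
    rw [one_div, inv_inv] at h
    refine h.congr fun n => ?_
    rw [inv_div, div_pow, neg_sq, mul_pow]
    ring
  have hα : ∀ᶠ n : ℕ in atTop, Nonempty (Fin n × Fin n) := by
    filter_upwards [eventually_ne_atTop 0] with n hn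
    have : NeZero n := ⟨hn⟩
    infer_instance
  have h := tendsto_expect_exp_I_mul_pairSum hα (fun n => tensorKernel_ordSign_comm)
    (fun n => expect_expect_tensorKernel_ordSign)
    (fun n a b => (abs_mul _ _).trans_le <|
      mul_le_one₀ (abs_ordSign_le_one ..) (abs_nonneg _) (abs_ordSign_le_one ..)) hv hs
  convert! h using 2 with n
  · exact expect_comp_concordance fun c => Complex.exp (Complex.I * (-t / (2 * σ n) * c : ℝ))
  · push_cast
    ring_nf

section UniformOn

variable {α β 𝕜 : Type*} [Fintype α] [MeasurableSpace α] [MeasurableSingletonClass α] [Fintype β]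
  [MeasurableSpace β] [MeasurableSingletonClass β] [RCLike 𝕜] {s : Set α} {t : Set β}

theorem integral_uniformOn {f : α → 𝕜} (hf : ∀ x ∉ s, f x = 0) :
    ∫ x, f x ∂uniformOn s = (Fintype.card α / s.ncard : ℝ) • 𝔼 x, f x := by
  rw [uniformOn, ProbabilityTheory.cond, integral_smul_measure,
    setIntegral_eq_integral_of_forall_compl_eq_zero hf, integral_fintype .of_finite,
    Measure.count_apply_finite _ s.toFinite, ← Set.ncard_eq_toFinset_card s, div_eq_inv_mul,
    mul_smul, Nat.cast_smul_eq_nsmul, Fintype.card_smul_expect]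
  simp only [ENNReal.toReal_inv, ENNReal.toReal_natCast, count_real_singleton, one_smul]

theorem integral_uniformOn_prod {f : α × β → 𝕜} (hf : ∀ p ∉ s ×ˢ t, f p = 0) :
    ∫ p, f p ∂(uniformOn s).prod (uniformOn t) =
      (Fintype.card α / s.ncard * (Fintype.card β / t.ncard) : ℝ) • 𝔼 p, f p := by
  have hright (x : α) : ∫ y, f (x, y) ∂uniformOn t =
      (Fintype.card β / t.ncard : ℝ) • 𝔼 y, f (x, y) :=
    integral_uniformOn fun y hy => hf _ fun h => hy h.2
  have hleft : ∀ x ∉ s, 𝔼 y, f (x, y) = 0 := fun x hx =>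
    Finset.expect_eq_zero fun y _ => hf _ fun h => hx h.1
  rw [integral_prod f .of_finite]
  simp only [hright]
  rw [integral_smul, integral_uniformOn hleft, smul_smul, mul_comm, ← Finset.univ_product_univ,
    Finset.expect_product]

end UniformOn

section KemenyDist

variable {α β : Type*} [LinearOrder α] [LinearOrder β] {n : ℕ}

theorem kemenyScore_apply (x : Fin n → α) (k l : Fin n) :
    kemenyScore x k l = √(1 / 2) * ordSign (x k) (x l) := by
  simp only [kemenyScore, Matrix.of_apply, ordSign]
  split_ifs <;> simp

theorem kemenyDist_eq_sub_concordance (x : Fin n → α) (y : Fin n → β) :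
    kemenyDist x y = ((n : ℝ) ^ 2 - n) / 2 - concordance x y / 2 := by
  have hentry (k l) : (kemenyScore x ⊙ (kemenyScore y)ᵀ) k l =
      -(1 / 2) * (ordSign (x k) (x l) * ordSign (y k) (y l)) := by
    rw [Matrix.hadamard_apply, Matrix.transpose_apply, kemenyScore_apply, kemenyScore_apply,
      ordSign_swap (y l) (y k)]
    have hsqrt := Real.mul_self_sqrt (show (0 : ℝ) ≤ 1 / 2 by norm_num)
    linear_combination (-(ordSign (x k) (x l) * ordSign (y k) (y l))) * hsqrt
  simp only [kemenyDist, hentry, ← Finset.mul_sum, concordance]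
  ring

end KemenyDist

section KemenyLaw

variable {n : ℕ}

theorem concordance_eq_zero {x y : Fin n → Fin n}
    (hxy : (x, y) ∉ kemenyPopulation n ×ˢ kemenyPopulation n) : concordance x y = 0 := by
  refine Finset.sum_eq_zero fun k _ => Finset.sum_eq_zero fun l _ => ?_
  have hconst : x k = x l ∨ y k = y l := by
    by_contra! h
    exact hxy ⟨⟨k, l, h.1⟩, ⟨k, l, h.2⟩⟩
  rcases hconst with h | h <;> simp only [h, ordSign_self, zero_mul, mul_zero]

theorem ncard_kemenyPopulation (hn : n ≠ 0) :
    ((kemenyPopulation n).ncard : ℝ) = (n : ℝ) ^ n - n := by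
  have : NeZero n := ⟨hn⟩
  have hcompl : (kemenyPopulation n)ᶜ = Set.range (Function.const (Fin n)) := by
    ext x
    simp only [kemenyPopulation, Set.mem_compl_iff, Set.mem_ofPred_eq, not_exists, ne_eq, not_not,
      Set.mem_range]
    exact ⟨fun h => ⟨x 0, funext fun k => h _ _⟩, by rintro ⟨a, rfl⟩ _ _; rfl⟩
  have hcard := Set.ncard_add_ncard_compl (kemenyPopulation n)
  rw [hcompl, Set.ncard_range_of_injective Function.const_injective, Nat.card_fun, Nat.card_fin]
    at hcard
  rw [eq_sub_iff_add_eq]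
  exact_mod_cast hcard

/-- The fraction of non-constant vectors among all vectors of length `n` with entries in `Fin n`. -/
def nonconstFraction (n : ℕ) : ℝ := 1 - n / (n : ℝ) ^ n

/-- The law of the Kemeny distance of two independent uniform rankings with ties. -/
def kemenyLaw (n : ℕ) : Measure ℝ :=
  ((uniformOn (kemenyPopulation n)).prod (uniformOn (kemenyPopulation n))).map
    fun p => kemenyDist p.1 p.2

theorem hasLaw_kemenyDist {Ω : Type*} [MeasurableSpace Ω] {P : Measure Ω} [IsFiniteMeasure P]
    {X Y : Ω → Fin n → Fin n} (hX : HasLaw X (uniformOn (kemenyPopulation n)) P)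
    (hY : HasLaw Y (uniformOn (kemenyPopulation n)) P) (hXY : IndepFun X Y P) :
    HasLaw (fun ω => kemenyDist (X ω) (Y ω)) (kemenyLaw n) P := by
  have hpair := (indepFun_iff_hasLaw_prodMk_prod hX hY).1 hXY
  have hdist : Measurable fun p : (Fin n → Fin n) × (Fin n → Fin n) => kemenyDist p.1 p.2 :=
    .of_discrete
  have hmap := hdist.measurePreserving
    ((uniformOn (kemenyPopulation n)).prod (uniformOn (kemenyPopulation n)))
  have hcomp := hmap.fun_comp_hasLaw hpair
  exact hcomp

theorem kemenyPopulation_nonempty (hn : 2 ≤ n) : (kemenyPopulation n).Nonempty :=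
  ⟨id, ⟨0, by lia⟩, ⟨1, by lia⟩, by simp⟩

theorem integral_kemenyLaw {𝕜 : Type*} [RCLike 𝕜] (hn : 2 ≤ n) {φ : ℝ → 𝕜} (hφ : Measurable φ) :
    ∫ x, φ x ∂kemenyLaw n = φ (((n : ℝ) ^ 2 - n) / 2) + (nonconstFraction n ^ 2)⁻¹ •
      ((𝔼 p : (Fin n → Fin n) × (Fin n → Fin n), φ (kemenyDist p.1 p.2)) -
        φ (((n : ℝ) ^ 2 - n) / 2)) := by
  have : NeZero n := ⟨by lia⟩
  have := isProbabilityMeasure_uniformOn (kemenyPopulation n).toFinite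
    (kemenyPopulation_nonempty hn)
  have hconst : ∀ p ∉ kemenyPopulation n ×ˢ kemenyPopulation n,
      φ (kemenyDist p.1 p.2) - φ (((n : ℝ) ^ 2 - n) / 2) = 0 := fun p hp => by
    rw [kemenyDist_eq_sub_concordance, concordance_eq_zero hp, zero_div, sub_zero, sub_self]
  have hfraction : (Fintype.card (Fin n → Fin n) / (kemenyPopulation n).ncard : ℝ) =
      (nonconstFraction n)⁻¹ := by
    have hn0 := NeZero.ne (n : ℝ)
    rw [ncard_kemenyPopulation (by lia), nonconstFraction, Fintype.card_fun, Fintype.card_fin,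
      Nat.cast_pow, one_sub_div (pow_ne_zero n hn0), inv_div]
  have h := integral_uniformOn_prod hconst
  rw [integral_sub .of_finite .of_finite, integral_const, probReal_univ, one_smul, hfraction,
    ← mul_inv, ← sq, Finset.expect_sub_distrib, Fintype.expect_const, sub_eq_iff_eq_add'] at h
  rw [kemenyLaw, integral_map Measurable.of_discrete.aemeasurable hφ.aestronglyMeasurable, h]

theorem centralMoment_eq_of_hasLaw {Ω : Type*} [MeasurableSpace Ω] {P : Measure Ω} {μ : Measure ℝ}
    {Z : Ω → ℝ} (hZ : HasLaw Z μ P) (r : ℕ) : centralMoment Z r P = centralMoment id r μ := by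
  have h := hZ.integral_comp (f := fun x => (x - ∫ y, y ∂μ) ^ r) (by fun_prop)
  rw [← hZ.integral_eq] at h
  simpa only [centralMoment, id_eq, ← hZ.integral_eq] using! h

theorem excessKurtosis_eq_of_hasLaw {Ω : Type*} [MeasurableSpace Ω] {P : Measure Ω} {μ : Measure ℝ}
    {Z : Ω → ℝ} (hZ : HasLaw Z μ P) : excessKurtosis Z P = excessKurtosis id μ := by
  rw [excessKurtosis, excessKurtosis, hZ.variance_eq, centralMoment_eq_of_hasLaw hZ]

theorem nonconstFraction_pos (hn : 2 ≤ n) : 0 < nonconstFraction n := by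
  have h1 : (1 : ℝ) < n := by exact_mod_cast hn
  rw [nonconstFraction, sub_pos, div_lt_one (by positivity)]
  exact lt_self_pow₀ h1 hn

theorem integral_id_kemenyLaw (hn : 2 ≤ n) : ∫ x, x ∂kemenyLaw n = ((n : ℝ) ^ 2 - n) / 2 := by
  have : NeZero n := ⟨by lia⟩
  rw [integral_kemenyLaw hn measurable_id']
  simp only [kemenyDist_eq_sub_concordance, Finset.expect_sub_distrib, ← Finset.expect_div,
    Fintype.expect_const, expect_concordance, zero_div, sub_zero, sub_self, smul_zero, add_zero]

theorem centralMoment_id_kemenyLaw (hn : 2 ≤ n) {r : ℕ} (hr : r ≠ 0) :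
    centralMoment id r (kemenyLaw n) =
      (𝔼 p : (Fin n → Fin n) × (Fin n → Fin n), concordance p.1 p.2 ^ r) / (-2) ^ r /
        nonconstFraction n ^ 2 := by
  have h := integral_kemenyLaw hn (φ := fun x => (x - ((n : ℝ) ^ 2 - n) / 2) ^ r) (by fun_prop)
  simp only [kemenyDist_eq_sub_concordance, sub_sub_cancel_left, sub_self, zero_pow hr, zero_add,
    sub_zero, ← div_neg, div_pow, ← Finset.expect_div, smul_eq_mul, ← div_eq_inv_mul] at h
  simpa only [centralMoment, id_eq, integral_id_kemenyLaw hn] using! h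

theorem variance_id_kemenyLaw (hn : 2 ≤ n) :
    variance id (kemenyLaw n) = concordanceVar n / nonconstFraction n ^ 2 := by
  have : NeZero n := ⟨by lia⟩
  rw [← centralMoment_two_eq_variance aemeasurable_id, centralMoment_id_kemenyLaw hn two_ne_zero,
    expect_concordance_sq]
  norm_num

/-- The ratio of the fourth moment to the squared second moment for the concordance of two
independent uniform vectors. -/
def concordanceKurtosis (n : ℕ) : ℝ := concordanceFourth n / concordanceVar n ^ 2

theorem excessKurtosis_id_kemenyLaw (hn : 2 ≤ n) :
    excessKurtosis id (kemenyLaw n) = nonconstFraction n ^ 2 * concordanceKurtosis n - 3 := by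
  have : NeZero n := ⟨by lia⟩
  have hp := (nonconstFraction_pos hn).ne'
  rw [excessKurtosis, variance_id_kemenyLaw hn, centralMoment_id_kemenyLaw hn four_ne_zero,
    expect_concordance_pow_four, concordanceKurtosis]
  norm_num
  field_simp

theorem charFun_map_kemenyLaw (hn : 2 ≤ n) (σ t : ℝ) :
    charFun ((kemenyLaw n).map fun x => (x - ((n : ℝ) ^ 2 - n) / 2) / σ) t =
      1 + (nonconstFraction n ^ 2)⁻¹ • ((𝔼 p : (Fin n → Fin n) × (Fin n → Fin n),
        Complex.exp (Complex.I * (-t / (2 * σ) * concordance p.1 p.2 : ℝ))) - 1) := by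
  rw [charFun_apply_real, integral_map (by fun_prop) (by fun_prop),
    integral_kemenyLaw hn (by fun_prop)]
  simp only [kemenyDist_eq_sub_concordance, sub_self, zero_div, Complex.ofReal_zero, mul_zero,
    zero_mul, Complex.exp_zero]
  congr! 5 with p
  rw [mul_comm Complex.I, ← Complex.ofReal_mul]
  congr 2
  ring

end KemenyLaw

section Kurtosis

variable {n : ℕ}

theorem nonconstFraction_le_one (n : ℕ) : nonconstFraction n ≤ 1 :=
  sub_le_self 1 (by positivity)

theorem nonconstFraction_eq (hn : n ≠ 0) : nonconstFraction n = 1 - ((n : ℝ) ^ (n - 1))⁻¹ := by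
  rw [nonconstFraction, ← mul_pow_sub_one hn, div_mul_cancel_left₀ (Nat.cast_ne_zero.2 hn)]

theorem nonconstFraction_le_succ (hn : n ≠ 0) :
    nonconstFraction n ≤ nonconstFraction (n + 1) := by
  rw [nonconstFraction_eq hn, nonconstFraction_eq n.succ_ne_zero]
  have h1 : (1 : ℝ) ≤ n := by exact_mod_cast Nat.one_le_iff_ne_zero.2 hn
  have hpow : (n : ℝ) ^ (n - 1) ≤ ((n + 1 : ℕ) : ℝ) ^ (n + 1 - 1) :=
    calc (n : ℝ) ^ (n - 1) ≤ (n : ℝ) ^ (n + 1 - 1) := pow_le_pow_right₀ h1 (by lia)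
      _ ≤ ((n + 1 : ℕ) : ℝ) ^ (n + 1 - 1) := by gcongr; lia
  gcongr

theorem tendsto_nonconstFraction : Tendsto nonconstFraction atTop (𝓝 1) := by
  have h : Tendsto (fun n : ℕ => (n : ℝ) / (n : ℝ) ^ n) atTop (𝓝 0) := by
    refine squeeze_zero' (Eventually.of_forall fun n => by positivity) ?_
      tendsto_one_div_atTop_nhds_zero_nat
    filter_upwards [eventually_ge_atTop 2] with n hn
    have h0 : (0 : ℝ) < n := by exact_mod_cast (by lia : 0 < n)
    have h1 : (1 : ℝ) ≤ n := by exact_mod_cast (by lia : 1 ≤ n)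
    rw [div_le_div_iff₀ (by positivity) h0, one_mul, ← sq]
    exact pow_le_pow_right₀ h1 hn
  simpa only [sub_zero] using! h.const_sub 1

/- The polynomial inequalities below hold because all coefficients become positive in the variable
`k = n - 2` or `k = n - 3`. -/

theorem concordanceVar_pos (hn : 2 ≤ n) : 0 < concordanceVar n := by
  obtain ⟨k, rfl⟩ := Nat.exists_eq_add_of_le hn
  have hpow : (0 : ℝ) < ((2 + k : ℕ) : ℝ) - 1 := by
    push_cast
    ring_nf
    positivity
  have hcubic : (0 : ℝ) < 2 * ((2 + k : ℕ) : ℝ) ^ 3 + 9 * ((2 + k : ℕ) : ℝ) ^ 2 -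
      6 * ((2 + k : ℕ) : ℝ) - 4 := by
    push_cast
    ring_nf
    positivity
  rw [concordanceVar]
  positivity

theorem concordanceKurtosis_eq (hn : 2 ≤ n) :
    concordanceKurtosis n =
      (300 * (n : ℝ) ^ 10 + 1584 * n ^ 9 - 4113 * n ^ 8 - 17601 * n ^ 7 + 34245 * n ^ 6
        + 100773 * n ^ 5 - 220962 * n ^ 4 - 68040 * n ^ 3 + 359064 * n ^ 2 - 108048 * n - 110016) /
      (25 * n * (n - 1) ^ 3 * (2 * n ^ 3 + 9 * n ^ 2 - 6 * n - 4) ^ 2) := by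
  have hn0 : (n : ℝ) ≠ 0 := Nat.cast_ne_zero.2 (by lia)
  have hvar := (concordanceVar_pos hn).ne'
  simp only [concordanceVar, ne_eq, div_eq_zero_iff, mul_eq_zero, not_or,
    pow_eq_zero_iff three_ne_zero] at hvar
  obtain ⟨⟨_, _⟩, _⟩ := hvar
  rw [concordanceKurtosis, concordanceFourth, concordanceVar]
  field_simp
  ring

theorem concordanceKurtosis_pos (hn : 3 ≤ n) : 0 < concordanceKurtosis n := by
  rw [concordanceKurtosis_eq (by lia)]
  obtain ⟨k, rfl⟩ := Nat.exists_eq_add_of_le hn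
  refine div_pos ?_ ?_ <;>
  · push_cast
    ring_nf
    positivity

theorem concordanceKurtosis_lt_three (hn : 3 ≤ n) : concordanceKurtosis n < 3 := by
  rw [concordanceKurtosis_eq (by lia)]
  obtain ⟨k, rfl⟩ := Nat.exists_eq_add_of_le hn
  rw [div_lt_iff₀, ← sub_pos] <;>
  · push_cast
    ring_nf
    positivity

theorem concordanceKurtosis_lt_succ (hn : 3 ≤ n) :
    concordanceKurtosis n < concordanceKurtosis (n + 1) := by
  rw [concordanceKurtosis_eq (by lia), concordanceKurtosis_eq (by lia)]
  obtain ⟨k, rfl⟩ := Nat.exists_eq_add_of_le hn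
  rw [div_lt_div_iff₀, ← sub_pos] <;>
  · push_cast
    ring_nf
    positivity

theorem tendsto_atTop_of_continuousAt_inv {f : ℕ → ℝ} {g : ℝ → ℝ} {a : ℝ} (hg : ContinuousAt g 0)
    (ha : g 0 = a) (hfg : ∀ᶠ n : ℕ in atTop, g (1 / n) = f n) :
    Tendsto f atTop (𝓝 a) := by
  subst ha
  exact (hg.tendsto.comp tendsto_one_div_atTop_nhds_zero_nat).congr' hfg

theorem tendsto_concordanceKurtosis : Tendsto concordanceKurtosis atTop (𝓝 3) := by
  refine tendsto_atTop_of_continuousAt_inv (g := fun u =>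
    (300 + 1584 * u - 4113 * u ^ 2 - 17601 * u ^ 3 + 34245 * u ^ 4 + 100773 * u ^ 5
      - 220962 * u ^ 6 - 68040 * u ^ 7 + 359064 * u ^ 8 - 108048 * u ^ 9 - 110016 * u ^ 10) /
    (25 * (1 - u) ^ 3 * (2 + 9 * u - 6 * u ^ 2 - 4 * u ^ 3) ^ 2))
    (ContinuousAt.div (by fun_prop) (by fun_prop) (by norm_num)) (by norm_num) ?_
  filter_upwards [eventually_ge_atTop 2] with n hn
  have hn0 : (n : ℝ) ≠ 0 := Nat.cast_ne_zero.2 (by lia)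
  rw [concordanceKurtosis_eq hn, ← mul_div_mul_right _ _ (pow_ne_zero 10 hn0)]
  congr 1 <;> field_simp

theorem tendsto_concordanceVar_div :
    Tendsto (fun n : ℕ => concordanceVar n / (n : ℝ) ^ 3) atTop (𝓝 (1 / 9)) := by
  refine tendsto_atTop_of_continuousAt_inv
    (g := fun u => (1 - u) ^ 3 * (2 + 9 * u - 6 * u ^ 2 - 4 * u ^ 3) / 18)
    (by fun_prop) (by norm_num) ?_
  filter_upwards [eventually_ge_atTop 2] with n hn
  have hn0 : (n : ℝ) ≠ 0 := Nat.cast_ne_zero.2 (by lia)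
  simp only [concordanceVar]
  field_simp

theorem kemenyPopVariance_nonneg (hn : n ≠ 0) : 0 ≤ kemenyPopVariance n := by
  have h1 : (1 : ℝ) ≤ n := by exact_mod_cast Nat.one_le_iff_ne_zero.2 hn
  have h2 : (0 : ℝ) ≤ 2 * n - 1 := by linarith
  rw [kemenyPopVariance]
  positivity

theorem tendsto_kemenyPopVariance_div :
    Tendsto (fun n : ℕ => kemenyPopVariance n / (n : ℝ) ^ 3) atTop (𝓝 (1 / 9)) := by
  refine tendsto_atTop_of_continuousAt_inv
    (g := fun u => (1 - u) ^ 2 * (1 + 4 * u) * (2 - u) / 18)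
    (by fun_prop) (by norm_num) ?_
  filter_upwards [eventually_ge_atTop 2] with n hn
  have hn0 : (n : ℝ) ≠ 0 := Nat.cast_ne_zero.2 (by lia)
  simp only [kemenyPopVariance]
  field_simp

end Kurtosis

section KemenyLimit

variable {n : ℕ}

theorem variance_id_kemenyLaw_pos (hn : 2 ≤ n) : 0 < variance id (kemenyLaw n) := by
  rw [variance_id_kemenyLaw hn]
  exact div_pos (concordanceVar_pos hn) (pow_pos (nonconstFraction_pos hn) 2)

theorem excessKurtosis_id_kemenyLaw_two : excessKurtosis id (kemenyLaw 2) = -2 := by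
  rw [excessKurtosis_id_kemenyLaw le_rfl]
  norm_num [nonconstFraction, concordanceKurtosis, concordanceFourth, concordanceVar]

theorem excessKurtosis_id_kemenyLaw_neg (hn : 2 ≤ n) : excessKurtosis id (kemenyLaw n) < 0 := by
  rcases hn.eq_or_lt with rfl | hn3
  · rw [excessKurtosis_id_kemenyLaw_two]
    norm_num
  · rw [excessKurtosis_id_kemenyLaw hn, sub_neg]
    calc nonconstFraction n ^ 2 * concordanceKurtosis n
        ≤ concordanceKurtosis n := mul_le_of_le_one_left (concordanceKurtosis_pos hn3).le
          (pow_le_one₀ (nonconstFraction_pos hn).le (nonconstFraction_le_one n))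
      _ < 3 := concordanceKurtosis_lt_three hn3

theorem excessKurtosis_id_kemenyLaw_lt_succ (hn : 2 ≤ n) :
    excessKurtosis id (kemenyLaw n) < excessKurtosis id (kemenyLaw (n + 1)) := by
  have hsucc : 2 ≤ n + 1 := by lia
  rcases hn.eq_or_lt with rfl | hn3
  · rw [excessKurtosis_id_kemenyLaw_two, excessKurtosis_id_kemenyLaw hsucc]
    norm_num [nonconstFraction, concordanceKurtosis, concordanceFourth, concordanceVar]
  · rw [excessKurtosis_id_kemenyLaw hn, excessKurtosis_id_kemenyLaw hsucc]
    have hp : nonconstFraction n ^ 2 ≤ nonconstFraction (n + 1) ^ 2 :=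
      pow_le_pow_left₀ (nonconstFraction_pos hn).le (nonconstFraction_le_succ (by lia)) 2
    exact sub_lt_sub_right (mul_lt_mul' hp (concordanceKurtosis_lt_succ hn3)
      (concordanceKurtosis_pos hn3).le (pow_pos (nonconstFraction_pos hsucc) 2)) 3

theorem tendsto_excessKurtosis_id_kemenyLaw :
    Tendsto (fun n => excessKurtosis id (kemenyLaw n)) atTop (𝓝 0) := by
  have h := ((tendsto_nonconstFraction.pow 2).mul tendsto_concordanceKurtosis).sub_const 3
  rw [one_pow, one_mul, sub_self] at h
  refine h.congr' ?_
  filter_upwards [eventually_ge_atTop 2] with n hn using (excessKurtosis_id_kemenyLaw hn).symm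

theorem tendsto_variance_id_kemenyLaw_div :
    Tendsto (fun n : ℕ => variance id (kemenyLaw n) / (n : ℝ) ^ 3) atTop (𝓝 (1 / 9)) := by
  have h := tendsto_concordanceVar_div.div (tendsto_nonconstFraction.pow 2) (by norm_num)
  rw [one_pow, div_one] at h
  refine h.congr' ?_
  filter_upwards [eventually_ge_atTop 2] with n hn
  rw [variance_id_kemenyLaw hn, Pi.div_apply, div_right_comm]

theorem tendsto_charFun_map_kemenyLaw {σ : ℕ → ℝ}
    (hσ : Tendsto (fun n : ℕ => σ n ^ 2 / (n : ℝ) ^ 3) atTop (𝓝 (1 / 9))) (t : ℝ) :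
    Tendsto (fun n => charFun ((kemenyLaw n).map fun x => (x - ((n : ℝ) ^ 2 - n) / 2) / σ n) t)
      atTop (𝓝 (charFun (gaussianReal 0 1) t)) := by
  have hp := (tendsto_nonconstFraction.pow 2).inv₀ (by norm_num)
  have h := (hp.smul ((tendsto_expect_exp_concordance hσ t).sub_const 1)).const_add 1
  rw [one_pow, inv_one, one_smul, add_sub_cancel] at h
  have hgauss : charFun (gaussianReal 0 1) t = Complex.exp (-(t : ℂ) ^ 2 / 2) := by
    rw [charFun_gaussianReal]
    simp [neg_div]
  rw [hgauss]
  refine h.congr' ?_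
  filter_upwards [eventually_ge_atTop 2] with n hn using (charFun_map_kemenyLaw hn (σ n) t).symm

theorem tendstoInDistribution_of_hasLaw_kemenyLaw {Ω : ℕ → Type*} [∀ n, MeasurableSpace (Ω n)]
    {P : ∀ n, Measure (Ω n)} [∀ n, IsProbabilityMeasure (P n)] {D : ∀ n, Ω n → ℝ}
    (hmeas : ∀ n, AEMeasurable (D n) (P n)) (hlaw : ∀ n, 2 ≤ n → HasLaw (D n) (kemenyLaw n) (P n))
    {m σ : ℕ → ℝ} (hm : ∀ n, 2 ≤ n → m n = ((n : ℝ) ^ 2 - n) / 2)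
    (hσ : Tendsto (fun n : ℕ => σ n ^ 2 / (n : ℝ) ^ 3) atTop (𝓝 (1 / 9))) :
    TendstoInDistribution (fun n ω => (D n ω - m n) / σ n) atTop (id : ℝ → ℝ) P
      (gaussianReal 0 1) := by
  refine ⟨fun n => ((hmeas n).sub_const _).div_const _, aemeasurable_id, ?_⟩
  refine ProbabilityMeasure.tendsto_iff_tendsto_charFun.2 fun t => ?_
  rw [ProbabilityMeasure.coe_mk, Measure.map_id]
  refine (tendsto_charFun_map_kemenyLaw hσ t).congr' ?_
  filter_upwards [eventually_ge_atTop 2] with n hn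
  rw [← (hlaw n hn).map_eq, AEMeasurable.map_map_of_aemeasurable (by fun_prop) (hmeas n), hm n hn]
  rfl

theorem aemeasurable_of_hasLaw_of_two_le {Ω : Type*} [MeasurableSpace Ω] {P : Measure Ω}
    {X : Ω → Fin n → Fin n} {μ : Measure (Fin n → Fin n)} (hX : 2 ≤ n → HasLaw X μ P) :
    AEMeasurable X P := by
  by_cases hn : 2 ≤ n
  · exact (hX hn).aemeasurable
  · have : Subsingleton (Fin n) := Fin.subsingleton_iff_le_one.2 (by lia)
    exact (measurable_of_subsingleton_codomain X).aemeasurable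

theorem aemeasurable_kemenyDist {Ω : Type*} [MeasurableSpace Ω] {P : Measure Ω}
    {X Y : Ω → Fin n → Fin n} (hX : AEMeasurable X P) (hY : AEMeasurable Y P) :
    AEMeasurable (fun ω => kemenyDist (X ω) (Y ω)) P := by
  have hdist : Measurable fun p : (Fin n → Fin n) × (Fin n → Fin n) => kemenyDist p.1 p.2 :=
    .of_discrete
  have h := hdist.comp_aemeasurable (hX.prodMk hY)
  exact h

end KemenyLimit

end

theorem mainTheorem4 {Ω : ℕ → Type*} [∀ n, MeasurableSpace (Ω n)]
    (P : ∀ n, Measure (Ω n)) [∀ n, IsProbabilityMeasure (P n)]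
    (X Y : ∀ n, Ω n → Fin n → Fin n)
    (hX : ∀ n, 2 ≤ n → HasLaw (X n) (uniformOn (kemenyPopulation n)) (P n))
    (hY : ∀ n, 2 ≤ n → HasLaw (Y n) (uniformOn (kemenyPopulation n)) (P n))
    (hXY : ∀ n, 2 ≤ n → IndepFun (X n) (Y n) (P n))
    (D : ∀ n, Ω n → ℝ) (hD : ∀ n ω, D n ω = kemenyDist (X n ω) (Y n ω)) :
    -- the centring and scaling constants
    (∀ n, 2 ≤ n → ∫ ω, D n ω ∂(P n) = ((n : ℝ) ^ 2 - n) / 2 ∧ 0 < variance (D n) (P n)) ∧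
    -- asymptotic normality, scaled by the exact standard deviation
    TendstoInDistribution
      (fun n ω => (D n ω - ∫ ω', D n ω' ∂(P n)) / √(variance (D n) (P n)))
      atTop (id : ℝ → ℝ) P (gaussianReal 0 1) ∧
    -- asymptotic normality, scaled by the closed-form standard deviation
    TendstoInDistribution
      (fun n ω => (D n ω - ((n : ℝ) ^ 2 - n) / 2) / √(kemenyPopVariance n))
      atTop (id : ℝ → ℝ) P (gaussianReal 0 1) ∧
    -- the excess kurtosis is negative and increases to `0`
    (∀ n, 2 ≤ n → excessKurtosis (D n) (P n) < 0) ∧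
    (∀ n, 2 ≤ n → excessKurtosis (D n) (P n) < excessKurtosis (D (n + 1)) (P (n + 1))) ∧
    Tendsto (fun n => excessKurtosis (D n) (P n)) atTop (𝓝 0) := by
  obtain rfl : D = fun n ω => kemenyDist (X n ω) (Y n ω) := funext₂ hD
  have hmeas n := aemeasurable_kemenyDist (aemeasurable_of_hasLaw_of_two_le (hX n))
    (aemeasurable_of_hasLaw_of_two_le (hY n))
  have hlaw n (hn : 2 ≤ n) := hasLaw_kemenyDist (hX n hn) (hY n hn) (hXY n hn)
  have hmean n (hn : 2 ≤ n) := (hlaw n hn).integral_eq.trans (integral_id_kemenyLaw hn)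
  have hkurt n (hn : 2 ≤ n) := excessKurtosis_eq_of_hasLaw (hlaw n hn)
  refine ⟨fun n hn => ⟨hmean n hn, ?_⟩, ?_, ?_, fun n hn => ?_, fun n hn => ?_, ?_⟩
  · rw [(hlaw n hn).variance_eq]
    exact variance_id_kemenyLaw_pos hn
  · refine tendstoInDistribution_of_hasLaw_kemenyLaw hmeas hlaw hmean
      (tendsto_variance_id_kemenyLaw_div.congr' ?_)
    filter_upwards [eventually_ge_atTop 2] with n hn
    rw [Real.sq_sqrt (variance_nonneg _ _), (hlaw n hn).variance_eq]
  · refine tendstoInDistribution_of_hasLaw_kemenyLaw hmeas hlaw (fun _ _ => rfl)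
      (tendsto_kemenyPopVariance_div.congr' ?_)
    filter_upwards [eventually_ne_atTop 0] with n hn
    rw [Real.sq_sqrt (kemenyPopVariance_nonneg hn)]
  · rw [hkurt n hn]
    exact excessKurtosis_id_kemenyLaw_neg hn
  · rw [hkurt n hn, hkurt (n + 1) (by lia)]
    exact excessKurtosis_id_kemenyLaw_lt_succ hn
  · refine tendsto_excessKurtosis_id_kemenyLaw.congr' ?_
    filter_upwards [eventually_ge_atTop 2] with n hn using (hkurt n hn).symm
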